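/- **Model (discrete time).** A *communicating timed automaton* (CTA) consists of finitely many timed automata $A_1,\dots,A_n$, a finite set of FIFO channels, each leading from one automaton to another and at most one for each ordered pair, and a finite message alphabet $\Sigma$. The directed graph with the automata as nodes and the channels as edges is the *topology*; the CTA is *acyclic* (polyforest topology) if the underlying undirected graph has no cycle. Every clock belongs to exactly one automaton (there are no global clocks) and has values in $\mathbb N$. A transition of $A_i$ leads from one location to another, checks a finite conjunction of constraints $x\bowtie k$ with $x$ a clock of $A_i$, $k\in\mathbb N$, $\bowtie\in\{<,\le,=,\ge,>\}$, resets a set of clocks of $A_i$, and performs one operation: no operation; writing a message $a\in\Sigma$, with age $0$, to the tail of a channel leaving $A_i$; or reading a message $a\in\Sigma$ from the head of a channel entering $A_i$, provided that its age lies in a given interval with endpoints in $\mathbb N$ and $\mathbb N\cup\{\infty\}$. At any moment either a single transition of one automaton is taken, or an amount $t\in\mathbb N$ of time passes, which increases all clocks and all message ages by $t$. A configuration consists of the locations and clock values of all automata and the contents of all channels (messages with ages); in the initial configuration every automaton is in its initial location, all clocks are $0$ and all channels are empty. **Theorem.** Reachability is undecidable for acyclic CTA consisting of three one-clock timed automata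 without global clocks. More precisely, let $T$ be any acyclic topology on three automata with two channels, for instance the pipeline $A_1\to A_2\to A_3$, the star $A_1\to A_2,\ A_1\to A_3$ or the broom $A_2\to A_1,\ A_3\to A_1$. Then no algorithm decides, for CTA with topology $T$ consisting of three timed automata with one clock each, 1. given a CTA and one of its configurations $\gamma$, whether $\gamma$ is reachable from the initial configuration; 2. given a CTA and locations $\ell_1,\ell_2,\ell_3$ of $A_1,A_2,A_3$, whether some configuration in which each $A_i$ is in location $\ell_i$ is reachable from the initial configuration. If moreover $T$ has a node to which there is a directed path from every node (as in the pipeline and the broom), then no algorithm decides 3. given a CTA with topology $T$ as above, one of its automata $A_i$ and a location $\ell$ of $A_i$, whether some configuration in which $A_i$ is in location $\ell$ is reachable from the initial configuration. -/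

import Mathlib

/-! Communicating timed automata (CTA) over discrete time, without global clocks.

All components are finite syntactic data (locations and messages are initial segments of `ℕ`), so
that a CTA can be the input of an algorithm. -/

/-- The comparison symbols `<, ≤, =, ≥, >` of clock constraints. -/
inductive Cmp
  | lt | le | eq | ge | gt

/-- `c.Holds a b` means that `a ⋈ b`, where `⋈` is the comparison symbol `c`. -/
def Cmp.Holds : Cmp → ℕ → ℕ → Prop
  | .lt, a, b => a < b
  | .le, a, b => a ≤ b
  | .eq, a, b => a = b
  | .ge, a, b => b ≤ a
  | .gt, a, b => b < a

/-- A clock constraint over `k` clocks: a finite conjunction of constraints `x ⋈ c`. -/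
abbrev Guard (k : ℕ) := List (Fin k × Cmp × ℕ)

/-- The valuation `ν` satisfies the clock constraint `g`. -/
def Guard.Sat {k : ℕ} (g : Guard k) (ν : Fin k → ℕ) : Prop :=
  ∀ p ∈ g, p.2.1.Holds (ν p.1) p.2.2

/-- An interval `<lo, hi>` with `lo ∈ ℕ` and `hi ∈ ℕ ∪ {∞}` (`none` is `∞`); each end is open or
closed. -/
structure AgeInterval where
  lo : ℕ
  loClosed : Bool
  hi : Option ℕ
  hiClosed : Bool

/-- Membership of an age in an interval. -/
def AgeInterval.Mem (I : AgeInterval) (t : ℕ) : Prop :=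
  (if I.loClosed = true then I.lo ≤ t else I.lo < t) ∧
    ∀ u, I.hi = some u → if I.hiClosed = true then t ≤ u else t < u

/-- The operation of a transition of one of `n` automata: the empty operation; writing message `a`
on the channel to automaton `j`; reading message `a`, if its age lies in `I`, from the channel
coming from automaton `j`. -/
inductive ChanOp (n : ℕ)
  | nop
  | write (j : Fin n) (a : ℕ)
  | read (j : Fin n) (a : ℕ) (I : AgeInterval)

/-- A transition `(src, guard, op, resets, tgt)`. -/
structure Transition (n k : ℕ) where
  src : ℕ
  guard : Guard k
  op : ChanOp n
  resets : List (Fin k)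
  tgt : ℕ

/-- A timed automaton with `k` clocks, inside a network of `n` automata. Its locations are
`0, …, numLocs - 1`. (Final locations play no role in reachability and are left out.) -/
structure TimedAut (n k : ℕ) where
  numLocs : ℕ
  init : ℕ
  trans : List (Transition n k)

/-- A network of `n` timed automata. Each automaton has its own `k` clocks; there are no global
clocks. `(i, j) ∈ channels` means that there is a channel from automaton `i` to automaton `j`. The
channel alphabet is `0, …, numMsgs - 1`. -/
structure CTA (n k : ℕ) where
  automata : Fin n → TimedAut n k
  channels : List (Fin n × Fin n)
  numMsgs : ℕ

/-- A configuration: locations and clock valuations of the automata, and the contents of the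
channels as words of messages with their ages. The newest message is the first letter, the oldest
one (which is the next to be read) is the last letter. -/
structure CTAConfig (n k : ℕ) where
  loc : Fin n → ℕ
  val : Fin n → Fin k → ℕ
  chan : Fin n → Fin n → List (ℕ × ℕ)

namespace CTAConfig

variable {n k : ℕ}

/-- `t` time units pass: all clocks and all ages of messages grow by `t`. -/
def elapse (γ : CTAConfig n k) (t : ℕ) : CTAConfig n k where
  loc := γ.loc
  val := fun i x => γ.val i x + t
  chan := fun i j => (γ.chan i j).map fun p => (p.1, p.2 + t)

/-- Automaton `i` goes to the target of the transition `e` and resets the clocks of `e`; nothing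
else changes. -/
def move (γ : CTAConfig n k) (i : Fin n) (e : Transition n k) : CTAConfig n k where
  loc := Function.update γ.loc i e.tgt
  val := Function.update γ.val i fun x => if x ∈ e.resets then 0 else γ.val i x
  chan := γ.chan

/-- The contents of the channel from `i` to `j` is replaced by `w`. -/
def setChan (γ : CTAConfig n k) (i j : Fin n) (w : List (ℕ × ℕ)) : CTAConfig n k where
  loc := γ.loc
  val := γ.val
  chan := Function.update γ.chan i (Function.update (γ.chan i) j w)

end CTAConfig

namespace CTA

variable {n k : ℕ}

/-- The network topology: the directed graph whose edges are the channels. -/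
def topology (N : CTA n k) : Finset (Fin n × Fin n) := N.channels.toFinset

/-- An operation that automaton `i` of `N` may perform: it writes on channels leaving `i` and reads
from channels entering `i`, and the message is in the channel alphabet. -/
def OpAllowed (N : CTA n k) (i : Fin n) : ChanOp n → Prop
  | .nop => True
  | .write j a => (i, j) ∈ N.topology ∧ a < N.numMsgs
  | .read j a _ => (j, i) ∈ N.topology ∧ a < N.numMsgs

/-- `N` is a syntactically correct network: initial locations, sources and targets of transitions
are locations, and all operations respect the topology and the channel alphabet. -/
def WellFormed (N : CTA n k) : Prop :=
  ∀ i, (N.automata i).init < (N.automata i).numLocs ∧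
    ∀ e ∈ (N.automata i).trans, e.src < (N.automata i).numLocs ∧
      e.tgt < (N.automata i).numLocs ∧ N.OpAllowed i e.op

/-- The transition `e` of automaton `i` can be taken in `γ`, as far as the location and the clocks
of automaton `i` are concerned. -/
def Enabled (N : CTA n k) (γ : CTAConfig n k) (i : Fin n) (e : Transition n k) : Prop :=
  e ∈ (N.automata i).trans ∧ γ.loc i = e.src ∧ e.guard.Sat (γ.val i)

/-- The transition relation of the network: passage of time (the same for all automata and
messages), internal transitions, writing (the new message has age `0`) and reading. -/
inductive Step (N : CTA n k) : CTAConfig n k → CTAConfig n k → Prop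
  | time (γ : CTAConfig n k) (t : ℕ) : Step N γ (γ.elapse t)
  | nop (γ : CTAConfig n k) (i : Fin n) (e : Transition n k) :
      N.Enabled γ i e → e.op = .nop → Step N γ (γ.move i e)
  | write (γ : CTAConfig n k) (i j : Fin n) (a : ℕ) (e : Transition n k) :
      N.Enabled γ i e → e.op = .write j a →
      Step N γ ((γ.move i e).setChan i j ((a, 0) :: γ.chan i j))
  | read (γ : CTAConfig n k) (i j : Fin n) (a : ℕ) (I : AgeInterval) (e : Transition n k)
      (w : List (ℕ × ℕ)) (t : ℕ) :
      N.Enabled γ i e → e.op = .read j a I → γ.chan j i = w ++ [(a, t)] → I.Mem t →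
      Step N γ ((γ.move i e).setChan j i w)

/-- The initial configuration: initial locations, all clocks `0`, all channels empty. -/
def initial (N : CTA n k) : CTAConfig n k where
  loc := fun i => (N.automata i).init
  val := fun _ _ => 0
  chan := fun _ _ => []

/-- `γ` is reachable from the initial configuration. -/
def Reaches (N : CTA n k) (γ : CTAConfig n k) : Prop :=
  Relation.ReflTransGen N.Step N.initial γ

/-- `γ` is a configuration of `N`: the locations exist, the channels contain monotonic timed words
over the channel alphabet, and there is nothing where there is no channel. -/
def IsConfig (N : CTA n k) (γ : CTAConfig n k) : Prop :=
  (∀ i, γ.loc i < (N.automata i).numLocs) ∧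
    ∀ i j, ((i, j) ∉ N.topology → γ.chan i j = []) ∧
      (∀ p ∈ γ.chan i j, p.1 < N.numMsgs) ∧
      (γ.chan i j).Pairwise fun p q => p.2 ≤ q.2

end CTA

/-- The underlying undirected graph of the directed graph `T` has no cycles (a loop and a pair of
opposite edges count as cycles). -/
def IsPolyforest {n : ℕ} (T : Finset (Fin n × Fin n)) : Prop :=
  (∀ i, (i, i) ∉ T) ∧ (∀ i j, (i, j) ∈ T → (j, i) ∉ T) ∧
    (SimpleGraph.fromRel fun i j => (i, j) ∈ T).IsAcyclic

/-! Coding of networks and configurations by natural numbers, through products, sums and lists. -/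

def Cmp.equivFin : Cmp ≃ Fin 5 where
  toFun
    | .lt => 0
    | .le => 1
    | .eq => 2
    | .ge => 3
    | .gt => 4
  invFun
    | 0 => .lt
    | 1 => .le
    | 2 => .eq
    | 3 => .ge
    | 4 => .gt
  left_inv := by rintro (_ | _ | _ | _ | _) <;> rfl
  right_inv := by decide

instance : Primcodable Cmp := Primcodable.ofEquiv _ Cmp.equivFin

def AgeInterval.equivProd : AgeInterval ≃ ℕ × Bool × Option ℕ × Bool where
  toFun I := (I.lo, I.loClosed, I.hi, I.hiClosed)
  invFun p := ⟨p.1, p.2.1, p.2.2.1, p.2.2.2⟩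
  left_inv _ := rfl
  right_inv _ := rfl

instance : Primcodable AgeInterval := Primcodable.ofEquiv _ AgeInterval.equivProd

def ChanOp.equivSum (n : ℕ) : ChanOp n ≃ Unit ⊕ (Fin n × ℕ) ⊕ (Fin n × ℕ × AgeInterval) where
  toFun
    | .nop => .inl ()
    | .write j a => .inr (.inl (j, a))
    | .read j a I => .inr (.inr (j, a, I))
  invFun
    | .inl _ => .nop
    | .inr (.inl p) => .write p.1 p.2
    | .inr (.inr p) => .read p.1 p.2.1 p.2.2
  left_inv := by rintro (_ | _ | _) <;> rfl
  right_inv := by rintro (_ | _ | _) <;> rfl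

instance (n : ℕ) : Primcodable (ChanOp n) := Primcodable.ofEquiv _ (ChanOp.equivSum n)

def Transition.equivProd (n k : ℕ) :
    Transition n k ≃ ℕ × Guard k × ChanOp n × List (Fin k) × ℕ where
  toFun e := (e.src, e.guard, e.op, e.resets, e.tgt)
  invFun p := ⟨p.1, p.2.1, p.2.2.1, p.2.2.2.1, p.2.2.2.2⟩
  left_inv _ := rfl
  right_inv _ := rfl

instance (n k : ℕ) : Primcodable (Transition n k) :=
  Primcodable.ofEquiv _ (Transition.equivProd n k)

def TimedAut.equivProd (n k : ℕ) : TimedAut n k ≃ ℕ × ℕ × List (Transition n k) where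
  toFun A := (A.numLocs, A.init, A.trans)
  invFun p := ⟨p.1, p.2.1, p.2.2⟩
  left_inv _ := rfl
  right_inv _ := rfl

instance (n k : ℕ) : Primcodable (TimedAut n k) := Primcodable.ofEquiv _ (TimedAut.equivProd n k)

def CTA.equivProd (n k : ℕ) :
    CTA n k ≃ (Fin n → TimedAut n k) × List (Fin n × Fin n) × ℕ where
  toFun N := (N.automata, N.channels, N.numMsgs)
  invFun p := ⟨p.1, p.2.1, p.2.2⟩
  left_inv _ := rfl
  right_inv _ := rfl

instance (n k : ℕ) : Primcodable (CTA n k) := Primcodable.ofEquiv _ (CTA.equivProd n k)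

def CTAConfig.equivProd (n k : ℕ) :
    CTAConfig n k ≃ (Fin n → ℕ) × (Fin n → Fin k → ℕ) × (Fin n → Fin n → List (ℕ × ℕ)) where
  toFun γ := (γ.loc, γ.val, γ.chan)
  invFun p := ⟨p.1, p.2.1, p.2.2⟩
  left_inv _ := rfl
  right_inv _ := rfl

instance (n k : ℕ) : Primcodable (CTAConfig n k) := Primcodable.ofEquiv _ (CTAConfig.equivProd n k)

/-- The decision problem with set of instances `D` and question `P` is undecidable: no computable
function gives the right answer on all instances (whatever it does on other inputs). -/
def UndecidableOn {α : Type} [Primcodable α] (D P : α → Prop) : Prop :=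
  ¬ ∃ f : α → Bool, Computable f ∧ ∀ x, D x → (f x = true ↔ P x)

/-! The halting problem of a two-counter machine is reduced to reachability, a counter being stored
as a time difference. With two channels and no cycle, one automaton of `T`, the middle, is linked to
both others, the leaves. A run of the machine is a word of letters, each giving the next state and
the action on the counters, and all three automata process the same word. The middle spends 2 time
units per letter; a leaf spends 1, 2 or 3, depending on what the letter does to its own counter. The
value of that counter is the delay between the writing and the reading of the current letter on the
link. A message cannot be read before it is written, so the delay never becomes negative and a
decrement at zero blocks; a test for zero demands age 0. If the leaf reads, an increment makes it
slower; if it writes, an increment makes it faster. One clock per automaton suffices, because it is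
reset at every letter and measures only the gap to the next one. A leaf accepts or guesses arbitrary
letters; only the middle checks that the word is a path of the machine.

Soundness: `Machine.Inv` describes a reachable configuration by the present time and the words
exchanged so far; `Machine.Inv.step` preserves it. When the middle has halted and the reading leaves
have finished, `Machine.Inv.halts` and `exec_of_timelyLink` extract a halting run. Completeness:
`timelyLink_of_exec` shows that the schedule of a run respects all channels,
`Machine.exists_reaches_inv` carries it out unit by unit, and `Machine.Halts.reaches` ends in one
fixed configuration. If the information flows to a single automaton, its final location alone
witnesses halting (`Machine.reaches_sink_iff`).

The initial counter value `N` enters only through the first waiting times. Hence one fixed machine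
with undecidable halting problem in `N` is enough, and the reduction changes nothing but clock
constants. Such a machine comes from `Machine.exists_undecidable`: partial recursive functions are
computed by register programs (`RegProg.Implementable.of_partrec'`), registers become exponents in a
Gödel number handled by two counters (`PairProg.exists_prog_of_partrec`), and programs become finite
automata (`Prog.run_toAuto`). Programs are nondeterministic relations throughout; an undefined value
means that there is no complete run. -/

/-! Programs built from actions by sequential composition, choice and iteration, and their
translation into finite automata. -/

/-- Regular expressions over actions, read as nondeterministic programs. -/
inductive Prog (α : Type)
  | skip
  | act (a : α)
  | seq (P Q : Prog α)
  | alt (P Q : Prog α)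
  | star (P : Prog α)

namespace Prog

/-- The input-output relation of a program, if `R a` is the relation of the action `a`. -/
def sem {α D : Type} (R : α → D → D → Prop) : Prog α → D → D → Prop
  | skip => fun d e => e = d
  | act a => R a
  | seq P Q => fun d e => ∃ c, sem R P d c ∧ sem R Q c e
  | alt P Q => fun d e => sem R P d e ∨ sem R Q d e
  | star P => Relation.ReflTransGen (sem R P)

/-- Replace each action by a program. -/
def bind {α β : Type} (h : α → Prog β) : Prog α → Prog β
  | skip => skip
  | act a => h a
  | seq P Q => seq (bind h P) (bind h Q)
  | alt P Q => alt (bind h P) (bind h Q)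
  | star P => star (bind h P)

/-- `k`-fold repetition. -/
def rep {α : Type} (P : Prog α) : ℕ → Prog α
  | 0 => skip
  | k + 1 => seq P (rep P k)

/-- Choice between the members of a finite family; `P 0` is always among them. -/
def choice {α : Type} (P : ℕ → Prog α) : ℕ → Prog α
  | 0 => P 0
  | k + 1 => alt (choice P k) (P (k + 1))

theorem sem_choice {α D : Type} (R : α → D → D → Prop) (P : ℕ → Prog α) (k : ℕ) (d e : D) :
    sem R (choice P k) d e ↔ ∃ r ≤ k, sem R (P r) d e := by
  induction k with
  | zero => simp [choice]
  | succ k ih =>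
    simp only [choice, sem, ih]
    constructor
    · rintro (⟨r, hr, h⟩ | h)
      · exact ⟨r, by omega, h⟩
      · exact ⟨k + 1, le_rfl, h⟩
    · rintro ⟨r, hr, h⟩
      rcases Nat.lt_or_ge k r with h1 | h1
      · obtain rfl : r = k + 1 := by omega
        exact .inr h
      · exact .inl ⟨r, h1, h⟩

/-- Simulating single actions suffices for simulating programs; `B` relates the data on the two
levels. This is the forward half of the passage from registers to two counters. -/
theorem sem_bind_of_sem {α β D D' : Type} {R : α → D → D → Prop} {R' : β → D' → D' → Prop}
    {h : α → Prog β} {B : D → D' → Prop}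
    (hB : ∀ a d e d', R a d e → B d d' → ∃ e', sem R' (h a) d' e' ∧ B e e') (P : Prog α) :
    ∀ d e d', sem R P d e → B d d' → ∃ e', sem R' (bind h P) d' e' ∧ B e e' := by
  induction P with
  | skip => rintro d e d' rfl hd; exact ⟨d', rfl, hd⟩
  | act a => exact hB a
  | seq P Q ihP ihQ =>
    rintro d e d' ⟨c, h1, h2⟩ hd
    obtain ⟨c', h1', hc⟩ := ihP _ _ _ h1 hd
    obtain ⟨e', h2', he⟩ := ihQ _ _ _ h2 hc
    exact ⟨e', ⟨c', h1', h2'⟩, he⟩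
  | alt P Q ihP ihQ =>
    rintro d e d' (h1 | h1) hd
    · obtain ⟨e', h, he⟩ := ihP _ _ _ h1 hd
      exact ⟨e', .inl h, he⟩
    · obtain ⟨e', h, he⟩ := ihQ _ _ _ h1 hd
      exact ⟨e', .inr h, he⟩
  | star P ih =>
    intro d e d' h1 hd
    induction h1 with
    | refl => exact ⟨d', .refl, hd⟩
    | tail _ h2 ih2 =>
      obtain ⟨c', hc', hc⟩ := ih2
      obtain ⟨e', he', he⟩ := ih _ _ _ h2 hc
      exact ⟨e', .tail hc' he', he⟩

/-- The converse simulation, needed because a concrete program might have spurious runs. -/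
theorem sem_of_sem_bind {α β D D' : Type} {R : α → D → D → Prop} {R' : β → D' → D' → Prop}
    {h : α → Prog β} {B : D → D' → Prop}
    (hB : ∀ a d d' e', sem R' (h a) d' e' → B d d' → ∃ e, R a d e ∧ B e e') (P : Prog α) :
    ∀ d d' e', sem R' (bind h P) d' e' → B d d' → ∃ e, sem R P d e ∧ B e e' := by
  induction P with
  | skip => rintro d d' e' rfl hd; exact ⟨d, rfl, hd⟩
  | act a => exact hB a
  | seq P Q ihP ihQ =>
    rintro d d' e' ⟨c, h1, h2⟩ hd
    obtain ⟨c', h1', hc⟩ := ihP _ _ _ h1 hd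
    obtain ⟨e', h2', he⟩ := ihQ _ _ _ h2 hc
    exact ⟨e', ⟨c', h1', h2'⟩, he⟩
  | alt P Q ihP ihQ =>
    rintro d d' e' (h1 | h1) hd
    · obtain ⟨e', h, he⟩ := ihP _ _ _ h1 hd
      exact ⟨e', .inl h, he⟩
    · obtain ⟨e', h, he⟩ := ihQ _ _ _ h1 hd
      exact ⟨e', .inr h, he⟩
  | star P ih =>
    intro d d' e' h1 hd
    induction h1 with
    | refl => exact ⟨d, .refl, hd⟩
    | tail _ h2 ih2 =>
      obtain ⟨c', hc', hc⟩ := ih2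
      obtain ⟨e', he', he⟩ := ih _ _ _ h2 hc
      exact ⟨e', .tail hc' he', he⟩

end Prog

/-! ### Thompson's construction of automata from programs. -/

/-- A nondeterministic automaton with one initial and one final state. -/
structure Auto (α : Type) where
  State : Type
  fintype : Fintype State
  step : State → α → State → Prop
  start : State
  fin : State

namespace Auto

variable {α D : Type} (R : α → D → D → Prop)

/-- Joint steps of the automaton and the data. -/
def Move (A : Auto α) (p q : A.State × D) : Prop :=
  ∃ a, A.step p.1 a q.1 ∧ R a p.2 q.2

/-- Joint runs of the automaton and the data. -/
abbrev Run (A : Auto α) : A.State × D → A.State × D → Prop :=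
  Relation.ReflTransGen (A.Move R)

/-- One transition. -/
def single (a : α) : Auto α where
  State := Bool
  fintype := inferInstance
  step s b t := s = false ∧ b = a ∧ t = true
  start := false
  fin := true

/-- Concatenation, with the silent action `ε`. -/
def concat (ε : α) (A B : Auto α) : Auto α where
  State := A.State ⊕ B.State
  fintype := @instFintypeSum _ _ A.fintype B.fintype
  step
    | .inl s, a, .inl t => A.step s a t
    | .inl s, a, .inr t => a = ε ∧ s = A.fin ∧ t = B.start
    | .inr _, _, .inl _ => False
    | .inr s, a, .inr t => B.step s a t
  start := .inl A.start
  fin := .inr B.fin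

/-- Union, with the silent action `ε`. -/
def union (ε : α) (A B : Auto α) : Auto α where
  State := Bool ⊕ A.State ⊕ B.State
  fintype := @instFintypeSum _ _ _ (@instFintypeSum _ _ A.fintype B.fintype)
  step
    | .inl s, a, .inr (.inl t) => a = ε ∧ s = false ∧ t = A.start
    | .inl s, a, .inr (.inr t) => a = ε ∧ s = false ∧ t = B.start
    | .inr (.inl s), a, .inl t => a = ε ∧ s = A.fin ∧ t = true
    | .inr (.inr s), a, .inl t => a = ε ∧ s = B.fin ∧ t = true
    | .inr (.inl s), a, .inr (.inl t) => A.step s a t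
    | .inr (.inr s), a, .inr (.inr t) => B.step s a t
    | _, _, _ => False
  start := .inl false
  fin := .inl true

/-- Iteration, with the silent action `ε`. -/
def iter (ε : α) (A : Auto α) : Auto α where
  State := Option A.State
  fintype := @instFintypeOption _ A.fintype
  step
    | none, a, some t => a = ε ∧ t = A.start
    | some s, a, none => a = ε ∧ s = A.fin
    | some s, a, some t => A.step s a t
    | none, _, none => False
  start := none
  fin := none

variable {R} {ε : α}

theorem run_single (a : α) (d e : D) :
    (single a).Run R ((single a).start, d) ((single a).fin, e) ↔ R a d e := by
  constructor
  · intro h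
    have key : ∀ p, (single a).Run R ((single a).start, d) p →
        p = (false, d) ∨ (p.1 = true ∧ R a d p.2) := by
      intro p hp
      induction hp with
      | refl => exact .inl rfl
      | tail _ h2 ih =>
        obtain ⟨b, ⟨h3, rfl, h4⟩, h5⟩ := h2
        rcases ih with rfl | ⟨h6, -⟩
        · exact .inr ⟨h4, h5⟩
        · rw [h6] at h3; cases h3
    rcases key _ h with h | h
    · cases h
    · exact h.2
  · exact fun h => .single ⟨a, ⟨rfl, rfl, rfl⟩, h⟩

/-- A run crosses the silent bridge from `A` to `B` exactly once, and it splits there. -/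
theorem run_concat (hε : ∀ d e, R ε d e ↔ e = d) (A B : Auto α) (d e : D) :
    (concat ε A B).Run R ((concat ε A B).start, d) ((concat ε A B).fin, e) ↔
      ∃ c, A.Run R (A.start, d) (A.fin, c) ∧ B.Run R (B.start, c) (B.fin, e) := by
  constructor
  · intro h
    have key : ∀ p, (concat ε A B).Run R ((concat ε A B).start, d) p →
        (∃ s, p.1 = .inl s ∧ A.Run R (A.start, d) (s, p.2)) ∨
        (∃ t, p.1 = .inr t ∧
          ∃ c, A.Run R (A.start, d) (A.fin, c) ∧ B.Run R (B.start, c) (t, p.2)) := by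
      intro p hp
      induction hp with
      | refl => exact .inl ⟨_, rfl, .refl⟩
      | @tail p q _ h2 ih =>
        obtain ⟨p1, p2⟩ := p
        obtain ⟨q1, q2⟩ := q
        obtain ⟨a, h3, h4⟩ := h2
        rcases ih with ⟨s, h5, h6⟩ | ⟨t, h5, c, h6, h7⟩
        · obtain rfl : p1 = .inl s := h5
          rcases q1 with u | u
          · exact .inl ⟨u, rfl, h6.tail ⟨a, h3, h4⟩⟩
          · obtain ⟨rfl, rfl, rfl⟩ := h3
            obtain rfl : q2 = p2 := (hε _ _).1 h4
            exact .inr ⟨_, rfl, q2, h6, .refl⟩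
        · obtain rfl : p1 = .inr t := h5
          rcases q1 with u | u
          · exact h3.elim
          · exact .inr ⟨u, rfl, c, h6, h7.tail ⟨a, h3, h4⟩⟩
    rcases key _ h with ⟨s, h1, -⟩ | ⟨t, h1, h2⟩
    · cases h1
    · cases h1; exact h2
  · rintro ⟨c, h1, h2⟩
    have h1' : (concat ε A B).Run R (.inl A.start, d) (.inl A.fin, c) :=
      Relation.ReflTransGen.lift (r := Auto.Move R _) (fun p => (Sum.inl p.1, p.2)) (fun p q h => h) _ _ h1
    have h2' : (concat ε A B).Run R (.inr B.start, c) (.inr B.fin, e) :=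
      Relation.ReflTransGen.lift (r := Auto.Move R _) (fun p => (Sum.inr p.1, p.2)) (fun p q h => h) _ _ h2
    exact (h1'.tail (c := (Sum.inr B.start, c)) ⟨ε, ⟨rfl, rfl, rfl⟩, (hε _ _).2 rfl⟩).trans h2'

/-- The initial state is fresh and never re-entered, so the branch chosen in the first step is kept.
-/
theorem run_union (hε : ∀ d e, R ε d e ↔ e = d) (A B : Auto α) (d e : D) :
    (union ε A B).Run R ((union ε A B).start, d) ((union ε A B).fin, e) ↔
      A.Run R (A.start, d) (A.fin, e) ∨ B.Run R (B.start, d) (B.fin, e) := by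
  constructor
  · intro h
    have key : ∀ p, (union ε A B).Run R ((union ε A B).start, d) p →
        p = (.inl false, d) ∨
        (∃ s, p.1 = .inr (.inl s) ∧ A.Run R (A.start, d) (s, p.2)) ∨
        (∃ s, p.1 = .inr (.inr s) ∧ B.Run R (B.start, d) (s, p.2)) ∨
        (p.1 = .inl true ∧
          (A.Run R (A.start, d) (A.fin, p.2) ∨ B.Run R (B.start, d) (B.fin, p.2))) := by
      intro p hp
      induction hp with
      | refl => exact .inl rfl
      | @tail p q _ h2 ih =>
        obtain ⟨p1, p2⟩ := p
        obtain ⟨q1, q2⟩ := q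
        obtain ⟨a, h3, h4⟩ := h2
        rcases ih with h5 | ⟨s, h5, h6⟩ | ⟨s, h5, h6⟩ | ⟨h5, h6⟩
        · cases h5
          rcases q1 with u | u | u
          · exact h3.elim
          · obtain ⟨rfl, -, rfl⟩ := h3
            obtain rfl : q2 = d := (hε _ _).1 h4
            exact .inr (.inl ⟨_, rfl, .refl⟩)
          · obtain ⟨rfl, -, rfl⟩ := h3
            obtain rfl : q2 = d := (hε _ _).1 h4
            exact .inr (.inr (.inl ⟨_, rfl, .refl⟩))
        · obtain rfl : p1 = .inr (.inl s) := h5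
          rcases q1 with u | u | u
          · obtain ⟨rfl, rfl, rfl⟩ := h3
            obtain rfl : q2 = p2 := (hε _ _).1 h4
            exact .inr (.inr (.inr ⟨rfl, .inl h6⟩))
          · exact .inr (.inl ⟨_, rfl, h6.tail ⟨a, h3, h4⟩⟩)
          · exact h3.elim
        · obtain rfl : p1 = .inr (.inr s) := h5
          rcases q1 with u | u | u
          · obtain ⟨rfl, rfl, rfl⟩ := h3
            obtain rfl : q2 = p2 := (hε _ _).1 h4
            exact .inr (.inr (.inr ⟨rfl, .inr h6⟩))
          · exact h3.elim
          · exact .inr (.inr (.inl ⟨_, rfl, h6.tail ⟨a, h3, h4⟩⟩))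
        · obtain rfl : p1 = .inl true := h5
          rcases q1 with u | u | u
          · exact h3.elim
          · cases h3.2.1
          · cases h3.2.1
    rcases key _ h with h1 | ⟨s, h1, -⟩ | ⟨s, h1, -⟩ | ⟨-, h1⟩
    · cases h1
    · cases h1
    · cases h1
    · exact h1
  · rintro (h1 | h1)
    · have h1' : (union ε A B).Run R (.inr (.inl A.start), d) (.inr (.inl A.fin), e) :=
        Relation.ReflTransGen.lift (r := Auto.Move R _) (fun p => (Sum.inr (Sum.inl p.1), p.2)) (fun p q h => h) _ _ h1
      exact .head (b := (Sum.inr (Sum.inl A.start), d)) ⟨ε, ⟨rfl, rfl, rfl⟩, (hε _ _).2 rfl⟩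
        (h1'.tail (c := (Sum.inl true, e)) ⟨ε, ⟨rfl, rfl, rfl⟩, (hε _ _).2 rfl⟩)
    · have h1' : (union ε A B).Run R (.inr (.inr B.start), d) (.inr (.inr B.fin), e) :=
        Relation.ReflTransGen.lift (r := Auto.Move R _) (fun p => (Sum.inr (Sum.inr p.1), p.2)) (fun p q h => h) _ _ h1
      exact .head (b := (Sum.inr (Sum.inr B.start), d)) ⟨ε, ⟨rfl, rfl, rfl⟩, (hε _ _).2 rfl⟩
        (h1'.tail (c := (Sum.inl true, e)) ⟨ε, ⟨rfl, rfl, rfl⟩, (hε _ _).2 rfl⟩)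

/-- The visits to the fresh state `none` cut a run into complete runs of `A`. -/
theorem run_iter (hε : ∀ d e, R ε d e ↔ e = d) (A : Auto α) (d e : D) :
    (iter ε A).Run R ((iter ε A).start, d) ((iter ε A).fin, e) ↔
      Relation.ReflTransGen (fun d e => A.Run R (A.start, d) (A.fin, e)) d e := by
  constructor
  · intro h
    have key : ∀ p, (iter ε A).Run R ((iter ε A).start, d) p →
        ∃ c, Relation.ReflTransGen (fun d e => A.Run R (A.start, d) (A.fin, e)) d c ∧
          (p = (none, c) ∨ ∃ s, p.1 = some s ∧ A.Run R (A.start, c) (s, p.2)) := by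
      intro p hp
      induction hp with
      | refl => exact ⟨d, .refl, .inl rfl⟩
      | @tail p q _ h2 ih =>
        obtain ⟨p1, p2⟩ := p
        obtain ⟨q1, q2⟩ := q
        obtain ⟨a, h3, h4⟩ := h2
        obtain ⟨c, hc, h5 | ⟨s, h5, h6⟩⟩ := ih
        · cases h5
          rcases q1 with _ | u
          · exact h3.elim
          · obtain ⟨rfl, rfl⟩ := h3
            obtain rfl : q2 = p2 := (hε _ _).1 h4
            exact ⟨_, hc, .inr ⟨_, rfl, .refl⟩⟩
        · obtain rfl : p1 = some s := h5
          rcases q1 with _ | u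
          · obtain ⟨rfl, rfl⟩ := h3
            obtain rfl : q2 = p2 := (hε _ _).1 h4
            exact ⟨q2, hc.tail h6, .inl rfl⟩
          · exact ⟨c, hc, .inr ⟨_, rfl, h6.tail ⟨a, h3, h4⟩⟩⟩
    obtain ⟨c, hc, h1 | ⟨s, h1, -⟩⟩ := key _ h
    · cases h1; exact hc
    · cases h1
  · intro h
    induction h with
    | refl => exact .refl
    | @tail c e _ h2 ih =>
      have h2' : (iter ε A).Run R (some A.start, c) (some A.fin, e) :=
        Relation.ReflTransGen.lift (r := Auto.Move R _) (fun p => (some p.1, p.2)) (fun p q h => h) _ _ h2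
      exact ih.trans (.head (b := (some A.start, c)) ⟨ε, ⟨rfl, rfl⟩, (hε _ _).2 rfl⟩
        (h2'.tail (c := (none, e)) ⟨ε, ⟨rfl, rfl⟩, (hε _ _).2 rfl⟩))

end Auto

/-- The automaton of a program. -/
def Prog.toAuto {α : Type} (ε : α) : Prog α → Auto α
  | skip => .single ε
  | act a => .single a
  | seq P Q => .concat ε (P.toAuto ε) (Q.toAuto ε)
  | alt P Q => .union ε (P.toAuto ε) (Q.toAuto ε)
  | star P => .iter ε (P.toAuto ε)

theorem Prog.run_toAuto {α D : Type} {R : α → D → D → Prop} {ε : α}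
    (hε : ∀ d e, R ε d e ↔ e = d) (P : Prog α) : ∀ d e : D,
    (P.toAuto ε).Run R ((P.toAuto ε).start, d) ((P.toAuto ε).fin, e) ↔ P.sem R d e := by
  induction P with
  | skip => exact fun d e => (Auto.run_single ε d e).trans (hε d e)
  | act a => exact Auto.run_single a
  | seq P Q ihP ihQ => exact fun d e => (Auto.run_concat hε _ _ d e).trans (by simp [ihP, ihQ, sem])
  | alt P Q ihP ihQ => exact fun d e => (Auto.run_union hε _ _ d e).trans (by simp [ihP, ihQ, sem])
  | star P ih => exact fun d e => (Auto.run_iter hε _ d e).trans (by simp [ih, sem])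

/-! Register machine programs for partial recursive functions. -/

/-- What can be done with a counter. -/
inductive Kind
  | keep | inc | dec | zero

/-- The effect on the value of the counter. -/
def Kind.eff : Kind → ℕ → ℕ → Prop
  | .keep, c, d => d = c
  | .inc, c, d => d = c + 1
  | .dec, c, d => c = d + 1
  | .zero, c, d => c = 0 ∧ d = 0

/-- Action `p.1` on register `p.2`. -/
def regStep (p : Kind × ℕ) (σ τ : ℕ → ℕ) : Prop :=
  ∃ c, p.1.eff (σ p.2) c ∧ τ = Function.update σ p.2 c

namespace RegProg

open Prog Function

/-- The meaning of a register program. -/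
abbrev rsem : Prog (Kind × ℕ) → (ℕ → ℕ) → (ℕ → ℕ) → Prop := sem regStep

/-- Increment register `i`. -/
def inc (i : ℕ) : Prog (Kind × ℕ) := .act (.inc, i)

/-- Run `B` as often as register `i` can be decremented, until it is zero. -/
def loop (i : ℕ) (B : Prog (Kind × ℕ)) : Prog (Kind × ℕ) :=
  .seq (.star (.seq (.act (.dec, i)) B)) (.act (.zero, i))

/-- Set register `i` to zero. -/
def clear (i : ℕ) : Prog (Kind × ℕ) := loop i .skip

/-- Add register `i` to `k` and set `i` to zero. -/
def move (i k : ℕ) : Prog (Kind × ℕ) := loop i (inc k)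

/-- Add register `i` to `k` and to `l` and set `i` to zero. -/
def moveBoth (i k l : ℕ) : Prog (Kind × ℕ) := loop i (.seq (inc k) (inc l))

/-- Add register `i` to `k`, using `t` as scratch. -/
def copy (i k t : ℕ) : Prog (Kind × ℕ) := .seq (moveBoth i t k) (move t i)

/-! ### Semantics of loops on registers. -/

variable {σ τ : ℕ → ℕ}

theorem rsem_seq (P Q : Prog (Kind × ℕ)) :
    rsem (.seq P Q) σ τ ↔ ∃ ρ, rsem P σ ρ ∧ rsem Q ρ τ := Iff.rfl

theorem rsem_inc (i : ℕ) : rsem (inc i) σ τ ↔ τ = update σ i (σ i + 1) := by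
  simp [inc, sem, regStep, Kind.eff]

theorem rsem_zero (i : ℕ) : rsem (.act (.zero, i)) σ τ ↔ σ i = 0 ∧ τ = σ := by
  simp only [sem, regStep, Kind.eff]
  constructor
  · rintro ⟨c, ⟨h1, rfl⟩, rfl⟩
    exact ⟨h1, by rw [update_eq_self_iff, h1]⟩
  · rintro ⟨h1, rfl⟩
    exact ⟨0, ⟨h1, rfl⟩, by rw [eq_comm, update_eq_self_iff, h1]⟩

theorem rsem_dec (i : ℕ) :
    rsem (.act (.dec, i)) σ τ ↔ σ i ≠ 0 ∧ τ = update σ i (σ i - 1) := by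
  simp only [sem, regStep, Kind.eff]
  constructor
  · rintro ⟨c, h1, rfl⟩
    exact ⟨by omega, by rw [h1]; rfl⟩
  · rintro ⟨h1, rfl⟩
    exact ⟨_, by omega, rfl⟩

/-- If the `j`-th iteration of the loop leads from `s j` to `s (j + 1)`, and only there, then the
loop leads from `s 0` to `s n`. -/
theorem rsem_loop {i n : ℕ} {B : Prog (Kind × ℕ)} (s : ℕ → ℕ → ℕ) (hs : ∀ j ≤ n, s j i = n - j)
    (hB : ∀ j < n, ∀ τ, rsem B (update (s j) i (n - j - 1)) τ ↔ τ = s (j + 1)) :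
    rsem (loop i B) (s 0) τ ↔ τ = s n := by
  have hstep : ∀ j < n, ∀ τ, rsem (.seq (.act (.dec, i)) B) (s j) τ ↔ τ = s (j + 1) := by
    intro j hj τ
    rw [rsem_seq, ← hB j hj, ← hs j hj.le]
    simp only [rsem_dec]
    constructor
    · rintro ⟨ρ, ⟨-, rfl⟩, h⟩; exact h
    · exact fun h => ⟨_, ⟨by rw [hs j hj.le]; omega, rfl⟩, h⟩
  rw [loop, rsem_seq]
  simp only [rsem_zero]
  constructor
  · rintro ⟨ρ, h1, h2, rfl⟩
    have key : ∀ ρ, rsem (.star (.seq (.act (.dec, i)) B)) (s 0) ρ → ∃ j ≤ n, ρ = s j := by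
      intro ρ h
      induction h with
      | refl => exact ⟨0, by omega, rfl⟩
      | @tail ρ ρ' _ h4 ih =>
        obtain ⟨j, hj, rfl⟩ := ih
        rcases hj.lt_or_eq with hj | rfl
        · exact ⟨j + 1, hj, (hstep j hj _).1 h4⟩
        · obtain ⟨_, h5, -⟩ := h4
          exact absurd (by rw [hs j le_rfl]; omega) ((rsem_dec i).1 h5).1
    obtain ⟨j, hj, rfl⟩ := key _ h1
    -- The iteration may stop at any `s j`, but the final test for zero passes only at `j = n`.
    rw [hs j hj] at h2
    obtain rfl : j = n := by omega
    rfl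
  · rintro rfl
    have key : ∀ j ≤ n, rsem (.star (.seq (.act (.dec, i)) B)) (s 0) (s j) := by
      intro j
      induction j with
      | zero => exact fun _ => .refl
      | succ j ih => exact fun hj => (ih (by omega)).tail ((hstep j hj _).2 rfl)
    exact ⟨_, key n le_rfl, by rw [hs n le_rfl]; omega, rfl⟩

theorem rsem_clear (i : ℕ) : rsem (clear i) σ τ ↔ τ = update σ i 0 := by
  have := rsem_loop (τ := τ) (i := i) (n := σ i) (B := .skip)
    (fun j => update σ i (σ i - j)) (by simp) (by simp [sem, Nat.sub_sub])
  simpa [clear] using this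

theorem rsem_move {i k : ℕ} (h : i ≠ k) :
    rsem (move i k) σ τ ↔ τ = update (update σ i 0) k (σ k + σ i) := by
  have := rsem_loop (τ := τ) (i := i) (n := σ i) (B := inc k)
    (fun j => update (update σ i (σ i - j)) k (σ k + j)) (by simp [h]) (by
      intro j hj τ
      rw [rsem_inc]
      refine Eq.congr_right (funext fun r => ?_)
      simp only [update_apply]
      split_ifs <;> omega)
  simpa [move] using this

theorem rsem_moveBoth {i k l : ℕ} (h : i ≠ k) (h' : i ≠ l) (h'' : k ≠ l) :
    rsem (moveBoth i k l) σ τ ↔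
      τ = update (update (update σ i 0) k (σ k + σ i)) l (σ l + σ i) := by
  have := rsem_loop (τ := τ) (i := i) (n := σ i) (B := .seq (inc k) (inc l))
    (fun j => update (update (update σ i (σ i - j)) k (σ k + j)) l (σ l + j)) (by simp [h, h']) (by
      intro j hj τ
      rw [rsem_seq]
      simp only [rsem_inc, exists_eq_left]
      refine Eq.congr_right (funext fun r => ?_)
      simp only [update_apply]
      split_ifs <;> omega)
  simpa [moveBoth, h'', h''.symm] using this

theorem rsem_copy {i k t : ℕ} (h : i ≠ k) (h' : i ≠ t) (h'' : k ≠ t) (ht : σ t = 0) :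
    rsem (copy i k t) σ τ ↔ τ = update σ k (σ k + σ i) := by
  rw [copy, rsem_seq]
  simp only [rsem_moveBoth h' h h''.symm, exists_eq_left, rsem_move h'.symm]
  refine Eq.congr_right (funext fun r => ?_)
  simp only [update_apply]
  split_ifs <;> subst_vars <;> omega

/-! ### Partial recursive functions on registers. -/

/-- `f` can be computed by register programs: from the registers `xs`, with the result in register
`o`, using the registers from `s` on as scratch. -/
def Implementable {n : ℕ} (f : List.Vector ℕ n →. ℕ) : Prop :=
  ∀ (xs : Fin n → ℕ) (o s : ℕ), (∀ i, xs i < s) → o < s → (∀ i, xs i ≠ o) →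
    ∃ P, ∀ σ : ℕ → ℕ, σ o = 0 → (∀ r, s ≤ r → σ r = 0) → ∀ τ,
      rsem P σ τ ↔ ∃ v ∈ f (.ofFn fun i => σ (xs i)), τ = update σ o v

theorem Implementable.zero : Implementable (n := 0) fun _ => Part.some 0 := by
  intro xs o s _ _ _
  refine ⟨.skip, fun σ h _ τ => ?_⟩
  simp only [sem, Part.mem_some_iff, exists_eq_left]
  rw [show update σ o 0 = σ by rw [update_eq_self_iff, h]]

theorem Implementable.get {n : ℕ} (i : Fin n) : Implementable fun v => Part.some (v.get i) := by
  intro xs o s h1 h2 h3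
  refine ⟨copy (xs i) o s, fun σ h hs τ => ?_⟩
  rw [rsem_copy (h3 i) (h1 i).ne h2.ne (hs s le_rfl)]
  simp [h]

theorem Implementable.succ : Implementable (n := 1) fun v => Part.some v.head.succ := by
  intro xs o s h1 h2 h3
  refine ⟨.seq (copy (xs 0) o s) (inc o), fun σ h hs τ => ?_⟩
  rw [rsem_seq]
  simp only [rsem_copy (h3 0) (h1 0).ne h2.ne (hs s le_rfl), exists_eq_left, rsem_inc]
  simp [h]

/-- The components are evaluated one after the other into the registers from `s` on. Their scratch
space starts at `t`, beyond all results, so earlier results survive. -/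
theorem exists_family {m n : ℕ} {g : Fin m → List.Vector ℕ n →. ℕ}
    (hg : ∀ i, Implementable (g i)) (xs : Fin n → ℕ) (s t : ℕ) (h1 : ∀ i, xs i < s)
    (ht : s + m ≤ t) :
    ∃ P, ∀ σ : ℕ → ℕ, (∀ r, s ≤ r → σ r = 0) → ∀ τ, rsem P σ τ ↔
      ∃ vs : Fin m → ℕ, (∀ i, vs i ∈ g i (.ofFn fun i => σ (xs i))) ∧
        τ = fun r => if h : s ≤ r ∧ r - s < m then vs ⟨r - s, h.2⟩ else σ r := by
  induction m with
  | zero => exact ⟨.skip, fun σ hs τ => by simp [sem]⟩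
  | succ m ih =>
    obtain ⟨P, hP⟩ := ih (g := fun i => g i.castSucc) (fun i => hg _) (by omega)
    obtain ⟨Q, hQ⟩ := hg (Fin.last m) xs (s + m) t (fun i => by have := h1 i; omega) (by omega)
      (fun i => by have := h1 i; omega)
    refine ⟨.seq P Q, fun σ hs τ => ?_⟩
    rw [rsem_seq]
    have hxs : ∀ (vs : Fin m → ℕ) (i : Fin n),
        (if h : s ≤ xs i ∧ xs i - s < m then vs ⟨xs i - s, h.2⟩ else σ (xs i)) = σ (xs i) := by
      intro vs i
      rw [dif_neg]
      have := h1 i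
      omega
    have key : ∀ vs : Fin m → ℕ, rsem Q (fun r =>
        if h : s ≤ r ∧ r - s < m then vs ⟨r - s, h.2⟩ else σ r) τ ↔
        ∃ v ∈ g (Fin.last m) (.ofFn fun i => σ (xs i)), τ = fun r =>
          if h : s ≤ r ∧ r - s < m + 1 then
            (Fin.snoc vs v : Fin (m + 1) → ℕ) ⟨r - s, h.2⟩ else σ r := by
      intro vs
      rw [hQ]
      · simp only [hxs]
        refine exists_congr fun v => and_congr_right fun _ => Eq.congr_right (funext fun r => ?_)
        by_cases hr : r = s + m
        · subst hr
          simp [Fin.snoc]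
        · rw [update_of_ne hr]
          by_cases hr' : s ≤ r ∧ r - s < m
          · rw [dif_pos hr', dif_pos ⟨hr'.1, by omega⟩]
            simp [Fin.snoc, hr'.2]
          · rw [dif_neg hr', dif_neg (by omega)]
      · rw [dif_neg (by omega), hs _ (by omega)]
      · intro r hr
        rw [dif_neg (by omega), hs _ (by omega)]
    constructor
    · rintro ⟨ρ, h2, h3⟩
      obtain ⟨vs, hvs, rfl⟩ := (hP σ hs ρ).1 h2
      obtain ⟨v, hv, rfl⟩ := (key vs).1 h3
      refine ⟨Fin.snoc vs v, fun i => ?_, rfl⟩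
      refine Fin.lastCases ?_ (fun i => ?_) i
      · simpa using hv
      · simpa using hvs i
    · rintro ⟨vs, hvs, rfl⟩
      refine ⟨_, (hP σ hs _).2 ⟨fun i => vs i.castSucc, fun i => hvs _, rfl⟩, ?_⟩
      refine (key fun i => vs i.castSucc).2 ⟨vs (Fin.last m), hvs _, ?_⟩
      have : (Fin.snoc (fun i => vs i.castSucc) (vs (Fin.last m)) : Fin (m + 1) → ℕ) = vs :=
        Fin.snoc_init_self vs
      rw [this]

theorem exists_clearFrom (s m : ℕ) : ∃ P, ∀ σ τ : ℕ → ℕ, rsem P σ τ ↔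
    τ = fun r => if s ≤ r ∧ r - s < m then 0 else σ r := by
  induction m with
  | zero => exact ⟨.skip, fun σ τ => by simp [sem]⟩
  | succ m ih =>
    obtain ⟨P, hP⟩ := ih
    refine ⟨.seq P (clear (s + m)), fun σ τ => ?_⟩
    rw [rsem_seq]
    simp only [hP, exists_eq_left, rsem_clear]
    refine Eq.congr_right (funext fun r => ?_)
    simp only [update_apply]
    split_ifs <;> first | rfl | omega

theorem mem_mOfFn {α : Type} {n : ℕ} (f : Fin n → Part α) (v : List.Vector α n) :
    v ∈ List.Vector.mOfFn f ↔ ∀ i, v.get i ∈ f i := by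
  induction n with
  | zero => simp [List.Vector.mOfFn, Pure.pure, List.Vector.eq_nil v]
  | succ n ih =>
    simp only [List.Vector.mOfFn, Part.bind_eq_bind, Part.mem_bind_iff, ih, Pure.pure,
      Part.mem_some_iff]
    constructor
    · rintro ⟨a, ha, w, hw, rfl⟩ i
      refine Fin.cases ?_ (fun i => ?_) i
      · simpa using ha
      · simpa using hw i
    · intro h
      refine ⟨v.head, by simpa using h 0, v.tail, fun i => ?_, by simp⟩
      simpa using h i.succ

/-- The values of the `g i` are put into the block from `s` on, which then serves as input of `f`.
The block is cleared at the end, since only `o` may differ from the initial store. -/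
theorem Implementable.comp {m n : ℕ} {f : List.Vector ℕ n →. ℕ}
    {g : Fin n → List.Vector ℕ m →. ℕ} (hf : Implementable f) (hg : ∀ i, Implementable (g i)) :
    Implementable fun v => (List.Vector.mOfFn fun i => g i v) >>= f := by
  intro xs o s h1 h2 h3
  obtain ⟨P, hP⟩ := exists_family hg xs s (s + n) h1 le_rfl
  obtain ⟨Q, hQ⟩ := hf (fun i => s + i) o (s + n) (fun i => by omega) (by omega)
    (fun i => by omega)
  obtain ⟨C, hC⟩ := exists_clearFrom s n
  refine ⟨.seq P (.seq Q C), fun σ ho hs τ => ?_⟩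
  simp only [rsem_seq]
  have key : ∀ (vs : Fin n → ℕ) (ρ), rsem Q (fun r =>
      if h : s ≤ r ∧ r - s < n then vs ⟨r - s, h.2⟩ else σ r) ρ ↔
      ∃ v ∈ f (.ofFn vs), ρ = update (fun r =>
        if h : s ≤ r ∧ r - s < n then vs ⟨r - s, h.2⟩ else σ r) o v := by
    intro vs ρ
    rw [hQ]
    · simp
    · rw [dif_neg (by omega), ho]
    · intro r hr
      rw [dif_neg (by omega), hs _ (by omega)]
  have fin : ∀ (vs : Fin n → ℕ) (v : ℕ), (fun r => if s ≤ r ∧ r - s < n then 0 else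
      update (fun r => if h : s ≤ r ∧ r - s < n then vs ⟨r - s, h.2⟩ else σ r) o v r) =
      update σ o v := by
    intro vs v
    funext r
    by_cases hr : s ≤ r ∧ r - s < n
    · rw [if_pos hr, update_of_ne (by omega), hs _ hr.1]
    · simp only [if_neg hr, update_apply, dif_neg hr]
  have hmem : ∀ v, v ∈ (List.Vector.mOfFn fun i => g i (.ofFn fun i => σ (xs i))) >>= f ↔
      ∃ w : List.Vector ℕ n, (∀ i, w.get i ∈ g i (.ofFn fun i => σ (xs i))) ∧ v ∈ f w :=
    fun v => Part.mem_bind_iff.trans (exists_congr fun w => and_congr_left' (mem_mOfFn _ w))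
  refine Iff.trans ?_ (exists_congr fun v => and_congr_left' (hmem v)).symm
  constructor
  · rintro ⟨ρ, hρ, ρ', hρ', h⟩
    obtain ⟨vs, hvs, rfl⟩ := (hP σ hs ρ).1 hρ
    obtain ⟨v, hv, rfl⟩ := (key vs _).1 hρ'
    exact ⟨v, ⟨.ofFn vs, by simpa using hvs, hv⟩, by rw [(hC _ _).1 h, fin]⟩
  · rintro ⟨v, ⟨w, hw, hv⟩, rfl⟩
    have hw' : w = .ofFn w.get := by simp
    refine ⟨_, (hP σ hs _).2 ⟨w.get, hw, rfl⟩, _, (key _ _).2 ⟨v, hw' ▸ hv, rfl⟩, ?_⟩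
    rw [hC, fin]

/-- Register `s` counts down from the recursion argument, `s + 1` holds the current index, `o` the
value of the recursion so far, and `s + 2` receives the next value before it is moved to `o`. -/
theorem Implementable.prec {n : ℕ} {f : List.Vector ℕ n → ℕ} {g : List.Vector ℕ (n + 2) → ℕ}
    (hf : Implementable fun v => Part.some (f v)) (hg : Implementable fun v => Part.some (g v)) :
    Implementable fun v : List.Vector ℕ (n + 1) => Part.some
      (v.head.rec (f v.tail) fun y IH => g (y ::ᵥ IH ::ᵥ v.tail) : ℕ) := by
  intro xs o s h1 h2 h3
  obtain ⟨P, hP⟩ := hf (fun i => xs i.succ) o s (fun i => h1 _) h2 (fun i => h3 _)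
  obtain ⟨Q, hQ⟩ := hg (Fin.cons (s + 1) (Fin.cons o fun i => xs i.succ)) (s + 2) (s + 3)
    (fun i => by
      refine Fin.cases ?_ (fun i => Fin.cases ?_ (fun i => ?_) i) i
      · simp
      · simp; omega
      · have := h1 i.succ
        simp; omega) (by omega)
    (fun i => by
      refine Fin.cases ?_ (fun i => Fin.cases ?_ (fun i => ?_) i) i
      · simp
      · simp; omega
      · have := h1 i.succ
        simp; omega)
  refine ⟨.seq P (.seq (copy (xs 0) s (s + 1)) (.seq (loop s (.seq Q (.seq (clear o)
    (.seq (move (s + 2) o) (inc (s + 1)))))) (clear (s + 1)))), fun σ ho hs τ => ?_⟩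
  simp only [Part.mem_some_iff, exists_eq_left, rsem_seq] at hP hQ ⊢
  simp only [hP σ ho hs, exists_eq_left]
  have hx0 := h1 0
  have hx0' := h3 0
  set w : List.Vector ℕ n := .ofFn fun i => σ (xs i.succ) with hw
  set F : ℕ → ℕ := fun j => Nat.rec (f w) (fun y IH => g (y ::ᵥ IH ::ᵥ w)) j with hF
  have hcopy : ∀ ρ, rsem (copy (xs 0) s (s + 1)) (update σ o (f w)) ρ ↔
      ρ = update (update σ o (f w)) s (σ (xs 0)) := by
    intro ρ
    rw [rsem_copy (by omega) (by omega) (by omega)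
      (by rw [update_of_ne (by omega), hs _ (by omega)])]
    rw [update_of_ne (by omega), update_of_ne hx0', hs s le_rfl, zero_add]
  simp only [hcopy, exists_eq_left]
  have hloop := fun ρ => rsem_loop (τ := ρ) (i := s) (n := σ (xs 0)) (B := .seq Q (.seq (clear o)
      (.seq (move (s + 2) o) (inc (s + 1)))))
    (fun j => update (update (update σ o (F j)) s (σ (xs 0) - j)) (s + 1) j)
    (by simp) (by
      intro j hj τ
      simp only [rsem_seq]
      have hQ' := fun ρ => hQ (update (update (update (update σ o (F j)) s (σ (xs 0) - j))
        (s + 1) j) s (σ (xs 0) - j - 1)) (by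
          rw [update_of_ne (by omega), update_of_ne (by omega), update_of_ne (by omega),
            update_of_ne (by omega), hs _ (by omega)]) (by
          intro r hr
          rw [update_of_ne (by omega), update_of_ne (by omega), update_of_ne (by omega),
            update_of_ne (by omega), hs _ (by omega)]) ρ
      simp only [hQ', exists_eq_left, rsem_clear, rsem_move (show s + 2 ≠ o by omega), rsem_inc]
      refine Eq.congr_right ?_
      have harg : (List.Vector.ofFn fun i => update (update (update (update σ o (F j)) s
          (σ (xs 0) - j)) (s + 1) j) s (σ (xs 0) - j - 1)
          ((Fin.cons (s + 1) (Fin.cons o fun i => xs i.succ) : Fin (n + 2) → ℕ) i)) =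
          j ::ᵥ F j ::ᵥ w := by
        refine List.Vector.ext fun i => ?_
        rw [List.Vector.get_ofFn]
        refine Fin.cases ?_ (fun i => Fin.cases ?_ (fun i => ?_) i) i
        · simp
        · simp only [Fin.cons_succ, Fin.cons_zero, List.Vector.get_cons_succ,
            List.Vector.get_cons_zero]
          rw [update_of_ne (by omega), update_of_ne (by omega), update_of_ne (by omega),
            update_self]
        · have := h1 i.succ
          have := h3 i.succ
          simp only [Fin.cons_succ, List.Vector.get_cons_succ, hw, List.Vector.get_ofFn]
          rw [update_of_ne (by omega), update_of_ne (by omega), update_of_ne (by omega),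
            update_of_ne (by omega)]
      rw [harg]
      have hFj : g (j ::ᵥ F j ::ᵥ w) = F (j + 1) := rfl
      rw [hFj]
      have hs2 := hs (s + 2) (by omega)
      funext r
      simp only [update_apply]
      split_ifs <;> first | omega | (subst_vars; simp_all))
  have h0 : update (update (update σ o (F 0)) s (σ (xs 0) - 0)) (s + 1) 0 =
      update (update σ o (f w)) s (σ (xs 0)) := by
    refine update_eq_self_iff.2 ?_
    rw [update_of_ne (by omega), update_of_ne (by omega), hs _ (by omega)]
  simp only [h0] at hloop
  simp only [hloop, exists_eq_left, rsem_clear]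
  refine Eq.congr_right ?_
  have hres : (Nat.rec (f (List.Vector.ofFn fun i => σ (xs i)).tail)
      (fun y IH => g (y ::ᵥ IH ::ᵥ (List.Vector.ofFn fun i => σ (xs i)).tail))
      (List.Vector.ofFn fun i => σ (xs i)).head : ℕ) = F (σ (xs 0)) := by
    have : (List.Vector.ofFn fun i => σ (xs i)).tail = w := by
      refine List.Vector.ext fun i => ?_
      simp [hw]
    rw [this]
    simp [hF]
  rw [hres]
  have hs0 := hs s le_rfl
  have hs1 := hs (s + 1) (by omega)
  funext r
  simp only [update_apply]
  split_ifs <;> first | omega | (subst_vars; simp_all)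

/-- Register `o` itself is the candidate and `s` receives the value of `f` there. Decrementing `s`
is possible exactly when the candidate fails, and the test for zero exactly when it succeeds, so the
nondeterministic iteration has no real freedom. -/
theorem Implementable.rfind {n : ℕ} {f : List.Vector ℕ (n + 1) → ℕ}
    (hf : Implementable fun v => Part.some (f v)) :
    Implementable fun v => Nat.rfind fun k => Part.some (decide (f (k ::ᵥ v) = 0)) := by
  intro xs o s h1 h2 h3
  obtain ⟨P, hP⟩ := hf (Fin.cons o xs) s (s + 1)
    (fun i => by
      refine Fin.cases ?_ (fun i => ?_) i
      · simp; omega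
      · have := h1 i
        simp; omega) (by omega)
    (fun i => by
      refine Fin.cases ?_ (fun i => ?_) i
      · simp; omega
      · have := h1 i
        simp; omega)
  simp only [Part.mem_some_iff, exists_eq_left] at hP
  refine ⟨.seq (.star (.seq P (.seq (.act (.dec, s)) (.seq (clear s) (inc o)))))
    (.seq P (.act (.zero, s))), fun σ ho hs τ => ?_⟩
  set w : List.Vector ℕ n := .ofFn fun i => σ (xs i) with hw
  have hs0 := hs s le_rfl
  have hP' : ∀ k ρ, rsem P (update σ o k) ρ ↔ ρ = update (update σ o k) s (f (k ::ᵥ w)) := by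
    intro k ρ
    rw [hP]
    · refine Eq.congr_right ?_
      congr 2
      refine List.Vector.ext fun i => ?_
      rw [List.Vector.get_ofFn]
      refine Fin.cases ?_ (fun i => ?_) i
      · simp
      · simp [hw, update_of_ne (h3 i)]
    · rw [update_of_ne (by omega), hs0]
    · intro r hr
      rw [update_of_ne (by omega), hs _ (by omega)]
  have hbody : ∀ k ρ, rsem (.seq P (.seq (.act (.dec, s)) (.seq (clear s) (inc o))))
      (update σ o k) ρ ↔ f (k ::ᵥ w) ≠ 0 ∧ ρ = update σ o (k + 1) := by
    intro k ρ
    simp only [rsem_seq, hP', exists_eq_left, rsem_dec, rsem_clear, rsem_inc]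
    have : ∀ c d, update (update (update (update (update σ o k) s c) s d) s 0) o
        (update (update (update (update σ o k) s c) s d) s 0 o + 1) = update σ o (k + 1) := by
      intro c d
      funext r
      simp only [update_apply]
      split_ifs <;> first | omega | (subst_vars; simp_all)
    constructor
    · rintro ⟨ρ', ⟨h, rfl⟩, rfl⟩
      exact ⟨by simpa using h, this _ _⟩
    · rintro ⟨h, rfl⟩
      exact ⟨_, ⟨by simpa using h, rfl⟩, (this _ _).symm⟩
  have hexit : ∀ k ρ, rsem (.seq P (.act (.zero, s))) (update σ o k) ρ ↔
      f (k ::ᵥ w) = 0 ∧ ρ = update σ o k := by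
    intro k ρ
    simp only [rsem_seq, hP', exists_eq_left, rsem_zero, update_self]
    refine and_congr_right fun h => ?_
    rw [h, show update (update σ o k) s 0 = update σ o k by
      rw [update_eq_self_iff, update_of_ne (by omega), hs0]]
  have h0 : σ = update σ o 0 := by rw [eq_comm, update_eq_self_iff, ho]
  rw [rsem_seq]
  refine Iff.trans ?_ (exists_congr fun v => and_congr_left' Nat.mem_rfind).symm
  constructor
  · rintro ⟨ρ, hρ, hτ⟩
    have key : ∀ ρ, rsem (.star (.seq P (.seq (.act (.dec, s)) (.seq (clear s) (inc o))))) σ ρ →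
        ∃ k, ρ = update σ o k ∧ ∀ j < k, f (j ::ᵥ w) ≠ 0 := by
      intro ρ h
      induction h with
      | refl => exact ⟨0, h0, by simp⟩
      | tail _ h5 ih =>
        obtain ⟨k, rfl, hk⟩ := ih
        obtain ⟨h6, h7⟩ := (hbody k _).1 h5
        refine ⟨k + 1, h7, fun j hj => ?_⟩
        rcases Nat.lt_succ_iff_lt_or_eq.1 hj with h | rfl
        exacts [hk j h, h6]
    obtain ⟨k, rfl, hk⟩ := key ρ hρ
    obtain ⟨h5, rfl⟩ := (hexit k τ).1 hτ
    exact ⟨k, ⟨by simpa using h5, fun {j} hj => by simpa using hk j hj⟩, rfl⟩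
  · rintro ⟨k, ⟨hk, hlt⟩, rfl⟩
    have key : ∀ j ≤ k, rsem (.star (.seq P (.seq (.act (.dec, s)) (.seq (clear s) (inc o))))) σ
        (update σ o j) := by
      intro j
      induction j with
      | zero => intro _; rw [← h0]; exact .refl
      | succ j ih =>
        intro hj
        exact (ih (by omega)).tail ((hbody j _).2 ⟨by simpa using hlt (show j < k from hj), rfl⟩)
    exact ⟨_, key k le_rfl, (hexit k _).2 ⟨by simpa using hk, rfl⟩⟩

theorem Implementable.of_primrec' {n : ℕ} {f : List.Vector ℕ n → ℕ} (hf : Nat.Primrec' f) :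
    Implementable fun v => Part.some (f v) := by
  induction hf with
  | zero => exact .zero
  | succ => exact .succ
  | get i => exact .get i
  | comp g _ _ ihf ihg =>
    have := Implementable.comp ihf ihg
    simpa [Vector.mOfFn_part_some] using this
  | prec _ _ ihf ihg => exact .prec ihf ihg

theorem Implementable.of_partrec' {n : ℕ} {f : List.Vector ℕ n →. ℕ} (hf : Nat.Partrec' f) :
    Implementable f := by
  induction hf with
  | prim hf => exact .of_primrec' hf
  | comp g _ _ ihf ihg => exact .comp ihf ihg
  | rfind _ ih => exact .rfind ih

end RegProg

/-! Two-counter machines with an undecidable halting problem. -/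

/-- The action of a letter on the first (`false`) or second (`true`) counter. -/
def letterKind : Bool → ℕ → Kind
  | false, 1 => .inc
  | false, 2 => .dec
  | false, 3 => .zero
  | true, 4 => .inc
  | true, 5 => .dec
  | true, 6 => .zero
  | _, _ => .keep

/-- The action of a letter on a pair of counters. -/
def pairStep (a : Fin 8) (p q : ℕ × ℕ) : Prop :=
  (letterKind false a).eff p.1 q.1 ∧ (letterKind true a).eff p.2 q.2

namespace PairProg

open Prog

/-- The meaning of a program over two counters. -/
abbrev psem : Prog (Fin 8) → ℕ × ℕ → ℕ × ℕ → Prop := sem pairStep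

variable {p q : ℕ × ℕ}

theorem psem_incA : psem (.act 1) p q ↔ q = (p.1 + 1, p.2) := by
  simp [sem, pairStep, letterKind, Kind.eff, Prod.ext_iff]

theorem psem_decA : psem (.act 2) p q ↔ p = (q.1 + 1, q.2) := by
  simp [sem, pairStep, letterKind, Kind.eff, Prod.ext_iff, eq_comm]

theorem psem_zeroA : psem (.act 3) p q ↔ p.1 = 0 ∧ q = p := by
  simp only [sem, pairStep, letterKind, Kind.eff, Prod.ext_iff]
  constructor
  · rintro ⟨⟨h1, h2⟩, h3⟩; exact ⟨h1, by omega, h3⟩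
  · rintro ⟨h1, h2, h3⟩; exact ⟨⟨h1, by omega⟩, h3⟩

theorem psem_incB : psem (.act 4) p q ↔ q = (p.1, p.2 + 1) := by
  simp [sem, pairStep, letterKind, Kind.eff, Prod.ext_iff]

theorem psem_decB : psem (.act 5) p q ↔ p = (q.1, q.2 + 1) := by
  simp [sem, pairStep, letterKind, Kind.eff, Prod.ext_iff, eq_comm]

theorem psem_zeroB : psem (.act 6) p q ↔ p.2 = 0 ∧ q = p := by
  simp only [sem, pairStep, letterKind, Kind.eff, Prod.ext_iff]
  constructor
  · rintro ⟨h3, h1, h2⟩; exact ⟨h1, h3, by omega⟩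
  · rintro ⟨h1, h2, h3⟩; exact ⟨h2, h1, by omega⟩

theorem psem_rep_incA (k : ℕ) : psem (rep (.act 1) k) p q ↔ q = (p.1 + k, p.2) := by
  induction k generalizing p with
  | zero => simp [rep, sem]
  | succ k ih =>
    change (∃ c, psem (.act 1) p c ∧ psem (rep (.act 1) k) c q) ↔ _
    simp only [psem_incA, ih, exists_eq_left]
    rw [add_assoc, add_comm 1]

theorem psem_rep_incB (k : ℕ) : psem (rep (.act 4) k) p q ↔ q = (p.1, p.2 + k) := by
  induction k generalizing p with
  | zero => simp [rep, sem]
  | succ k ih =>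
    change (∃ c, psem (.act 4) p c ∧ psem (rep (.act 4) k) c q) ↔ _
    simp only [psem_incB, ih, exists_eq_left]
    rw [add_assoc, add_comm 1]

theorem psem_rep_decA (k : ℕ) : psem (rep (.act 2) k) p q ↔ p = (q.1 + k, q.2) := by
  induction k generalizing p with
  | zero => simp [rep, sem, eq_comm]
  | succ k ih =>
    change (∃ c, psem (.act 2) p c ∧ psem (rep (.act 2) k) c q) ↔ _
    simp only [psem_decA, ih, exists_eq_right]
    rw [add_assoc]

/-! ### Arithmetic with two counters. -/

/-- Subtract `j` from the first counter and add `k` to the second one, any number of times. -/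
def toB (j k : ℕ) : Prog (Fin 8) := .star (.seq (rep (.act 2) j) (rep (.act 4) k))

/-- Add the second counter to the first one and set it to zero. -/
def toA : Prog (Fin 8) := .seq (.star (.seq (.act 5) (.act 1))) (.act 6)

theorem psem_toB (j k : ℕ) :
    psem (toB j k) p q ↔ ∃ i, p.1 = q.1 + i * j ∧ q.2 = p.2 + i * k := by
  have body : ∀ p q, psem (.seq (rep (.act 2) j) (rep (.act 4) k)) p q ↔
      p.1 = q.1 + j ∧ q.2 = p.2 + k := by
    intro p q
    change (∃ c, psem (rep (.act 2) j) p c ∧ psem (rep (.act 4) k) c q) ↔ _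
    simp only [psem_rep_decA, psem_rep_incB, Prod.ext_iff]
    constructor
    · rintro ⟨c, h⟩; omega
    · rintro h; exact ⟨(q.1, p.2), by simp; omega⟩
  constructor
  · intro h
    induction h with
    | refl => exact ⟨0, by simp⟩
    | tail _ h2 ih =>
      obtain ⟨i, hi⟩ := ih
      have := (body _ _).1 h2
      exact ⟨i + 1, by simp only [add_mul]; omega⟩
  · rintro ⟨i, hi⟩
    induction i generalizing q with
    | zero =>
      have : q = p := Prod.ext (by omega) (by omega)
      subst this
      exact .refl
    | succ i ih =>
      simp only [add_mul, one_mul] at hi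
      exact .tail (ih (q := (q.1 + j, p.2 + i * k)) (by simp; omega))
        ((body _ _).2 (by simp; omega))

theorem psem_toA : psem toA p q ↔ q = (p.1 + p.2, 0) := by
  have body : ∀ p q, psem (.seq (.act 5) (.act 1)) p q ↔ p.2 = q.2 + 1 ∧ q.1 = p.1 + 1 := by
    intro p q
    change (∃ c, psem (.act 5) p c ∧ psem (.act 1) c q) ↔ _
    simp only [psem_decB, psem_incA, Prod.ext_iff]
    constructor
    · rintro ⟨c, h⟩; omega
    · rintro h; exact ⟨(p.1, q.2), by simp; omega⟩
  change (∃ c, Relation.ReflTransGen (psem (.seq (.act 5) (.act 1))) p c ∧ psem (.act 6) c q) ↔ _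
  simp only [psem_zeroB]
  constructor
  · rintro ⟨c, h, h0, rfl⟩
    have : q.1 + q.2 = p.1 + p.2 := by
      clear h0
      induction h with
      | refl => rfl
      | tail _ h2 ih => have := (body _ _).1 h2; omega
    exact Prod.ext (by simp; omega) h0
  · rintro rfl
    refine ⟨_, ?_, rfl, rfl⟩
    obtain ⟨a, b⟩ := p
    induction b generalizing a with
    | zero => exact .refl
    | succ b ih =>
      refine .head ((body _ (a + 1, b)).2 ⟨rfl, rfl⟩) ?_
      have := ih (a + 1)
      simp only [] at this ⊢
      rwa [add_right_comm] at this

/-- Multiply the first counter by `k`. -/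
def mul (k : ℕ) : Prog (Fin 8) := .seq (toB 1 k) (.seq (.act 3) toA)

/-- Divide the first counter by `k`, if this is possible without remainder. -/
def div (k : ℕ) : Prog (Fin 8) := .seq (toB k 1) (.seq (.act 3) toA)

/-- Test that the first counter is not divisible by `k + 2`. -/
def notDvd (k : ℕ) : Prog (Fin 8) :=
  .seq (toB (k + 2) (k + 2)) (.seq
    (choice (fun r => .seq (rep (.act 2) (r + 1)) (.seq (.act 3) (rep (.act 1) (r + 1)))) k) toA)

theorem psem_mul (k N : ℕ) : psem (mul k) (N, 0) q ↔ q = (N * k, 0) := by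
  change (∃ c, psem (toB 1 k) (N, 0) c ∧ ∃ d, psem (.act 3) c d ∧ psem toA d q) ↔ _
  simp only [psem_toB, psem_zeroA, psem_toA]
  constructor
  · rintro ⟨c, ⟨i, h1, h2⟩, d, ⟨h3, rfl⟩, rfl⟩
    obtain rfl : N = i := by simpa [h3] using h1
    simp [h3, h2]
  · rintro rfl
    exact ⟨(0, N * k), ⟨N, by simp⟩, _, ⟨rfl, rfl⟩, by simp⟩

/-- The test for zero after `toB` forces the transfer to be exhaustive; if `k` does not divide `N`,
every run blocks there. -/
theorem psem_div (k N : ℕ) : psem (div k) (N, 0) q ↔ N = q.1 * k ∧ q.2 = 0 := by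
  change (∃ c, psem (toB k 1) (N, 0) c ∧ ∃ d, psem (.act 3) c d ∧ psem toA d q) ↔ _
  simp only [psem_toB, psem_zeroA, psem_toA]
  constructor
  · rintro ⟨c, ⟨i, h1, h2⟩, d, ⟨h3, rfl⟩, rfl⟩
    simp_all
  · rintro ⟨rfl, h⟩
    exact ⟨(0, q.1), ⟨q.1, by simp⟩, _, ⟨rfl, rfl⟩, Prod.ext (by simp) h⟩

/-- Any number of multiples of `k + 2` may be moved away, but the choice accepts only a rest
strictly between `0` and `k + 2`. Such a rest exists exactly when `k + 2` does not divide `N`;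
afterwards the counter is restored. -/
theorem psem_notDvd (k N : ℕ) : psem (notDvd k) (N, 0) q ↔ ¬ k + 2 ∣ N ∧ q = (N, 0) := by
  have test : ∀ c d, psem (choice (fun r => .seq (rep (.act 2) (r + 1))
      (.seq (.act 3) (rep (.act 1) (r + 1)))) k) c d ↔ (0 < c.1 ∧ c.1 < k + 2) ∧ d = c := by
    intro c d
    change sem pairStep _ c d ↔ _
    rw [sem_choice]
    have : ∀ r, sem pairStep (.seq (rep (.act 2) (r + 1))
        (.seq (.act 3) (rep (.act 1) (r + 1)))) c d ↔ c.1 = r + 1 ∧ d = c := by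
      intro r
      change (∃ x, psem (rep (.act 2) (r + 1)) c x ∧ ∃ y, psem (.act 3) x y ∧
        psem (rep (.act 1) (r + 1)) y d) ↔ _
      simp only [psem_rep_decA, psem_zeroA, psem_rep_incA]
      constructor
      · rintro ⟨x, rfl, y, ⟨h, rfl⟩, rfl⟩
        simp [h]
      · rintro ⟨h, rfl⟩
        exact ⟨(0, d.2), Prod.ext (by simp [h]) rfl, _, ⟨rfl, rfl⟩, Prod.ext (by simp [h]) rfl⟩
    simp only [this]
    constructor
    · rintro ⟨r, h1, h2, h3⟩; exact ⟨by omega, h3⟩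
    · rintro ⟨h1, h2⟩; exact ⟨c.1 - 1, by omega, by omega, h2⟩
  change (∃ c, psem (toB (k + 2) (k + 2)) (N, 0) c ∧ ∃ d, psem (choice _ k) c d ∧
    psem toA d q) ↔ _
  simp only [psem_toB, test, psem_toA]
  constructor
  · rintro ⟨c, ⟨i, h1, h2⟩, d, ⟨h3, rfl⟩, rfl⟩
    refine ⟨fun h => ?_, Prod.ext (by simp; omega) rfl⟩
    rw [h1, Nat.dvd_add_left (Dvd.intro_left i rfl)] at h
    exact absurd (Nat.le_of_dvd h3.1 h) (by omega)
  · rintro ⟨h, rfl⟩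
    have h1 := Nat.mod_add_div N (k + 2)
    have h2 := Nat.mod_lt N (show 0 < k + 2 by omega)
    have h3 : N % (k + 2) ≠ 0 := fun h0 => h (Nat.dvd_of_mod_eq_zero h0)
    exact ⟨(N % (k + 2), N / (k + 2) * (k + 2)), ⟨N / (k + 2), by simp only []; grind, by simp⟩,
      _, ⟨⟨by simp only []; omega, h2⟩, rfl⟩, Prod.ext (by simp only []; grind) rfl⟩

/-! ### Gödel numbers of register stores. -/

/-- The prime number for register `i`. -/
noncomputable def pr (i : ℕ) : ℕ := Nat.nth Nat.Prime i

theorem prime_pr (i : ℕ) : (pr i).Prime := Nat.prime_nth_prime i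

theorem pr_injective : Function.Injective pr := Nat.nth_injective Nat.infinite_setOfPred_prime

/-- Register actions on the Gödel number of the registers. -/
noncomputable def goedel : Kind × ℕ → Prog (Fin 8)
  | (.keep, _) => .skip
  | (.inc, i) => mul (pr i)
  | (.dec, i) => div (pr i)
  | (.zero, i) => notDvd (pr i - 2)

/-- The first counter is a Gödel number of the registers, the second one is zero. -/
def Represents (σ : ℕ → ℕ) (q : ℕ × ℕ) : Prop :=
  q.2 = 0 ∧ q.1 ≠ 0 ∧ ∀ i, q.1.factorization (pr i) = σ i

theorem factorization_mul_pr (N : ℕ) (hN : N ≠ 0) (i j : ℕ) :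
    (N * pr i).factorization (pr j) = N.factorization (pr j) + if j = i then 1 else 0 := by
  rw [Nat.factorization_mul hN (prime_pr i).ne_zero, Finsupp.add_apply,
    (prime_pr i).factorization, Finsupp.single_apply]
  simp only [pr_injective.eq_iff, eq_comm]

theorem factorization_pr_eq_zero (N : ℕ) (hN : N ≠ 0) (i : ℕ) :
    N.factorization (pr i) = 0 ↔ ¬ pr i ∣ N := by
  simp [Nat.factorization_eq_zero_iff, prime_pr, hN]

theorem pr_sub_two (i : ℕ) : pr i - 2 + 2 = pr i := Nat.sub_add_cancel (prime_pr i).two_le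

/-- Registers are exponents of distinct primes, so increment, decrement and test for zero become
multiplication, exact division and a test of non-divisibility. Nonvanishing of the Gödel number
makes exponents additive. -/
theorem psem_goedel_of_regStep (a : Kind × ℕ) (σ τ : ℕ → ℕ) (q : ℕ × ℕ) (h : regStep a σ τ)
    (hq : Represents σ q) : ∃ q', psem (goedel a) q q' ∧ Represents τ q' := by
  obtain ⟨k, i⟩ := a
  obtain ⟨N, z⟩ := q
  obtain ⟨rfl, hN, hq⟩ := hq
  obtain ⟨c, h1, rfl⟩ := h
  simp only [] at h1 hN hq ⊢
  cases k <;> simp only [Kind.eff] at h1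
  · subst h1
    exact ⟨_, rfl, rfl, hN, by simpa using hq⟩
  · subst h1
    refine ⟨_, (psem_mul _ _).2 rfl, rfl, mul_ne_zero hN (prime_pr i).ne_zero, fun j => ?_⟩
    rw [factorization_mul_pr N hN, hq, Function.update_apply]
    split_ifs with hj <;> simp [hj]
  · have hd : pr i ∣ N := by
      by_contra hd
      rw [← factorization_pr_eq_zero N hN, hq] at hd
      omega
    obtain ⟨M, rfl⟩ := hd
    have hM : M ≠ 0 := by rintro rfl; simp at hN
    refine ⟨(M, 0), (psem_div _ _).2 ⟨mul_comm _ _, rfl⟩, rfl, hM, fun j => ?_⟩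
    have := hq j
    rw [mul_comm, factorization_mul_pr M hM] at this
    rw [Function.update_apply]
    simp only []
    split_ifs at this ⊢ with hj
    · subst hj; omega
    · omega
  · obtain ⟨h1, rfl⟩ := h1
    refine ⟨(N, 0), (psem_notDvd _ _).2 ⟨?_, rfl⟩, rfl, hN, ?_⟩
    · rw [pr_sub_two, ← factorization_pr_eq_zero N hN, hq, h1]
    · rw [Function.update_eq_self_iff.2 h1.symm]
      exact hq

theorem regStep_of_psem_goedel (a : Kind × ℕ) (σ : ℕ → ℕ) (q q' : ℕ × ℕ)
    (h : psem (goedel a) q q') (hq : Represents σ q) :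
    ∃ τ, regStep a σ τ ∧ Represents τ q' := by
  obtain ⟨k, i⟩ := a
  obtain ⟨N, z⟩ := q
  obtain ⟨rfl, hN, hq⟩ := hq
  simp only [] at h hN hq ⊢
  cases k <;> simp only [goedel] at h
  · obtain rfl : q' = (N, 0) := h
    exact ⟨σ, ⟨σ i, rfl, by simp⟩, rfl, hN, hq⟩
  · obtain rfl := (psem_mul _ _).1 h
    refine ⟨_, ⟨σ i + 1, rfl, rfl⟩, rfl, mul_ne_zero hN (prime_pr i).ne_zero, fun j => ?_⟩
    rw [factorization_mul_pr N hN, hq, Function.update_apply]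
    split_ifs with hj <;> simp [hj]
  · obtain ⟨rfl, h2⟩ := (psem_div _ _).1 h
    have hM : q'.1 ≠ 0 := by intro h; simp [h] at hN
    have key := fun j => (factorization_mul_pr q'.1 hM i j).symm.trans (hq j)
    refine ⟨_, ⟨σ i - 1, ?_, rfl⟩, h2, hM, fun j => ?_⟩
    · have := key i
      rw [if_pos rfl] at this
      change σ i = σ i - 1 + 1
      omega
    · have := key j
      rw [Function.update_apply]
      simp only []
      split_ifs at this ⊢ with hj
      · subst hj; omega
      · omega
  · obtain ⟨h1, rfl⟩ := (psem_notDvd _ _).1 h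
    rw [pr_sub_two, ← factorization_pr_eq_zero N hN, hq] at h1
    exact ⟨σ, ⟨0, ⟨h1, rfl⟩, (Function.update_eq_self_iff.2 h1.symm).symm⟩, rfl, hN, hq⟩

theorem exists_prog_of_partrec {f : ℕ →. ℕ} (hf : Nat.Partrec f) :
    ∃ (P : Prog (Fin 8)) (g : ℕ → ℕ), Computable g ∧
      ∀ e, (∃ q, psem P (g e, 0) q) ↔ (f e).Dom := by
  have hf' : Nat.Partrec' fun v : List.Vector ℕ 1 => f v.head :=
    Nat.Partrec'.part_iff₁.2 (Partrec.nat_iff.2 hf)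
  obtain ⟨P, hP⟩ := RegProg.Implementable.of_partrec' hf' (fun _ => 0) 1 2 (by simp) (by simp)
    (by simp)
  -- The input sits in register 0, the result goes to register 1 and all other registers start at
  -- zero, so the initial Gödel number is a power of the first prime.
  refine ⟨P.bind goedel, fun e => pr 0 ^ e, ?_, fun e => ?_⟩
  · have := Primrec.nat_rec₁ (f := fun _ y => y * pr 0) 1
      (Primrec.nat_mul.comp Primrec.snd (Primrec.const _))
    refine this.to_comp.of_eq fun e => ?_
    induction e with
    | zero => rfl
    | succ e ih => rw [pow_succ, ← ih]
  · have hσ : Represents (Function.update 0 0 e) (pr 0 ^ e, 0) := by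
      refine ⟨rfl, pow_ne_zero _ (prime_pr 0).ne_zero, fun i => ?_⟩
      simp only []
      rw [(prime_pr 0).factorization_pow, Finsupp.single_apply, Function.update_apply]
      simp only [pr_injective.eq_iff, eq_comm, Pi.zero_apply]
    have key := hP (Function.update 0 0 e) (by simp) (fun r hr => by
      rw [Function.update_of_ne (by omega)]; rfl)
    simp only [Function.update_self] at key
    constructor
    · rintro ⟨q, hq⟩
      obtain ⟨τ, hτ, -⟩ := sem_of_sem_bind regStep_of_psem_goedel P _ _ _ hq hσ
      obtain ⟨v, hv, -⟩ := (key τ).1 hτ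
      exact Part.dom_iff_mem.2 ⟨v, by simpa using hv⟩
    · intro h
      obtain ⟨v, hv⟩ := Part.dom_iff_mem.1 h
      obtain ⟨q, hq, -⟩ := sem_bind_of_sem psem_goedel_of_regStep P _ _ _
        ((key _).2 ⟨v, by simpa using hv, rfl⟩) hσ
      exact ⟨q, hq⟩

end PairProg

/-! ### Two-counter machines and their runs as words. -/

/-- A two-counter machine. An edge `(q, ℓ)` leads from state `q` to state `ℓ / 8` and performs the
action of the letter `ℓ % 8`. State `0` is initial and is never entered again; state `1` is the
halting state and is never left. -/
structure Machine where
  numStates : ℕ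
  edges : List (ℕ × ℕ)
  two_le : 2 ≤ numStates
  src_lt : ∀ p ∈ edges, p.1 < numStates
  src_ne : ∀ p ∈ edges, p.1 ≠ 1
  tgt_lt : ∀ p ∈ edges, p.2 / 8 < numStates
  tgt_ne : ∀ p ∈ edges, p.2 / 8 ≠ 0
  halt_keep : ∀ p ∈ edges, p.2 / 8 = 1 → p.2 % 8 = 0

/-- What the letter `ℓ` does to the first or second counter. -/
def kindOf (s : Bool) (ℓ : ℕ) : Kind := letterKind s (ℓ % 8)

theorem kindOf_of_mod_eq_zero {ℓ : ℕ} (h : ℓ % 8 = 0) (s : Bool) : kindOf s ℓ = .keep := by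
  cases s <;> simp [kindOf, h, letterKind]

/-- The state after reading a word, whose first letter is the last one that was read. -/
def stateAfter : List ℕ → ℕ
  | [] => 0
  | ℓ :: _ => ℓ / 8

/-- The value of one counter after performing a word from the value `c₀` can be `c`. -/
def Exec (s : Bool) (c₀ : ℕ) : List ℕ → ℕ → Prop
  | [], c => c = c₀
  | ℓ :: w, c => ∃ b, Exec s c₀ w b ∧ (kindOf s ℓ).eff b c

namespace Machine

/-- The word labels a path from the initial state. -/
def Valid (M : Machine) : List ℕ → Prop
  | [] => True
  | ℓ :: w => (stateAfter w, ℓ) ∈ M.edges ∧ M.Valid w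

/-- The machine reaches the halting state from counter values `N` and `0`. -/
def Halts (M : Machine) (N : ℕ) : Prop :=
  ∃ ℓ w, M.Valid (ℓ :: w) ∧ ℓ / 8 = 1 ∧ (∃ c, Exec false N w c) ∧ ∃ c, Exec true 0 w c

theorem exists_of_auto (A : Auto (Fin 8)) : ∃ M : Machine, ∀ N,
    M.Halts N ↔ ∃ q, A.Run pairStep (A.start, (N, 0)) (A.fin, q) := by
  classical
  let := A.fintype
  obtain ⟨num⟩ : Nonempty (A.State ≃ Fin (Fintype.card A.State)) := ⟨Fintype.equivFin _⟩
  -- The states of `A` are shifted by 2 to keep `0` and `1` free for the new initial and halting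
  -- states, which are attached by letters that leave both counters alone.
  let E : List (ℕ × ℕ) := (0, 8 * (num A.start + 2)) :: (num A.fin + 2, 8) ::
    ((Finset.univ : Finset (A.State × Fin 8 × A.State)).toList.filter
      fun t => A.step t.1 t.2.1 t.2.2).map
      fun t => ((num t.1 : ℕ) + 2, 8 * ((num t.2.2 : ℕ) + 2) + t.2.1)
  have hE : ∀ p, p ∈ E ↔ p = (0, 8 * ((num A.start : ℕ) + 2)) ∨ p = ((num A.fin : ℕ) + 2, 8) ∨
      ∃ s a t, A.step s a t ∧ p = ((num s : ℕ) + 2, 8 * ((num t : ℕ) + 2) + a) := by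
    intro p
    simp [E, eq_comm]
  have hcase : ∀ {C : ℕ × ℕ → Prop}, C (0, 8 * ((num A.start : ℕ) + 2)) →
      C ((num A.fin : ℕ) + 2, 8) →
      (∀ (s t : A.State) (a : Fin 8), C ((num s : ℕ) + 2, 8 * ((num t : ℕ) + 2) + a)) →
      ∀ p ∈ E, C p := by
    intro C h1 h2 h3 p hp
    rcases (hE p).1 hp with rfl | rfl | ⟨s, a, t, -, rfl⟩
    exacts [h1, h2, h3 s t a]
  let M : Machine :=
    { numStates := Fintype.card A.State + 2
      edges := E
      two_le := by omega
      src_lt := hcase (by simp) (by simp) (by simp)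
      src_ne := hcase (by simp) (by simp) (by simp)
      tgt_lt := hcase (by simp) (by simp) (fun s t a => by simp only []; omega)
      tgt_ne := hcase (by simp) (by simp) (fun s t a => by simp only []; omega)
      halt_keep := hcase (by simp) (by simp) (fun s t a => by simp only []; omega) }
  refine ⟨M, fun N => ?_⟩
  constructor
  · rintro ⟨ℓ, w, hw, hℓ, ⟨c, hc⟩, d, hd⟩
    have key : ∀ w c d, M.Valid w → Exec false N w c → Exec true 0 w d →
        (w = [] ∧ c = N ∧ d = 0) ∨ stateAfter w = 1 ∨
        ∃ s, stateAfter w = (num s : ℕ) + 2 ∧ A.Run pairStep (A.start, (N, 0)) (s, (c, d)) := by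
      intro w
      induction w with
      | nil => exact fun c d _ h1 h2 => .inl ⟨rfl, h1, h2⟩
      | cons ℓ w ih =>
        rintro c d ⟨hℓ, hw⟩ ⟨c', h1, h1'⟩ ⟨d', h2, h2'⟩
        refine .inr ?_
        rcases (hE _).1 hℓ with h | h | ⟨s, a, t, hst, h⟩
        · obtain ⟨h3, rfl⟩ := Prod.mk.inj h
          refine .inr ⟨A.start, by simp [stateAfter], ?_⟩
          rcases ih c' d' hw h1 h2 with ⟨-, rfl, rfl⟩ | h4 | ⟨s, h4, -⟩
          · rw [kindOf_of_mod_eq_zero (by omega)] at h1' h2'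
            obtain rfl : c = c' := h1'
            obtain rfl : d = 0 := h2'
            exact .refl
          · omega
          · omega
        · obtain ⟨h3, rfl⟩ := Prod.mk.inj h
          exact .inl rfl
        · obtain ⟨h3, rfl⟩ := Prod.mk.inj h
          have hmod : (8 * ((num t : ℕ) + 2) + a) % 8 = a := by omega
          rw [kindOf, hmod] at h1' h2'
          refine .inr ⟨t, by simp only [stateAfter]; omega, ?_⟩
          rcases ih c' d' hw h1 h2 with ⟨rfl, -⟩ | h4 | ⟨s', h4, h5⟩
          · simp [stateAfter] at h3
          · omega
          · obtain rfl : s' = s := num.injective (Fin.ext (by omega))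
            exact h5.tail ⟨a, hst, h1', h2'⟩
    rcases (hE _).1 hw.1 with h | h | ⟨s, a, t, hst, h⟩
    · obtain ⟨-, rfl⟩ := Prod.mk.inj h
      omega
    · obtain ⟨h3, -⟩ := Prod.mk.inj h
      rcases key w c d hw.2 hc hd with ⟨rfl, -⟩ | h4 | ⟨s', h4, h5⟩
      · simp [stateAfter] at h3
      · omega
      · obtain rfl : s' = A.fin := num.injective (Fin.ext (by omega))
        exact ⟨_, h5⟩
    · obtain ⟨-, rfl⟩ := Prod.mk.inj h
      omega
  · rintro ⟨q, hq⟩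
    have key : ∀ r, A.Run pairStep (A.start, (N, 0)) r → ∃ w, M.Valid w ∧
        stateAfter w = (num r.1 : ℕ) + 2 ∧ Exec false N w r.2.1 ∧ Exec true 0 w r.2.2 := by
      intro r hr
      induction hr with
      | refl =>
        refine ⟨[8 * ((num A.start : ℕ) + 2)], ⟨(hE _).2 (.inl rfl), trivial⟩,
          by simp [stateAfter], ⟨N, rfl, ?_⟩, ⟨0, rfl, ?_⟩⟩ <;>
        · rw [kindOf_of_mod_eq_zero (by omega)]
          rfl
      | @tail r r' _ h2 ih =>
        obtain ⟨w, h3, h4, h5, h6⟩ := ih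
        obtain ⟨a, h7, h8, h9⟩ := h2
        have hmod : (8 * ((num r'.1 : ℕ) + 2) + a) % 8 = a := by omega
        refine ⟨(8 * ((num r'.1 : ℕ) + 2) + a) :: w,
          ⟨(hE _).2 (.inr (.inr ⟨_, a, _, h7, by rw [h4]⟩)), h3⟩, by simp only [stateAfter]; omega,
          ⟨_, h5, ?_⟩, ⟨_, h6, ?_⟩⟩
        · rw [kindOf, hmod]; exact h8
        · rw [kindOf, hmod]; exact h9
    obtain ⟨w, h1, h2, h3, h4⟩ := key _ hq
    exact ⟨8, w, ⟨(hE _).2 (.inr (.inl (by rw [h2]))), h1⟩, rfl, ⟨_, h3⟩, ⟨_, h4⟩⟩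

/-- There is a machine whose halting problem is undecidable. -/
theorem exists_undecidable : ∃ (M : Machine) (g : ℕ → ℕ), Computable g ∧
    ¬ ∃ f : ℕ → Bool, Computable f ∧ ∀ e, f e = true ↔ M.Halts (g e) := by
  -- The source of undecidability is whether the code numbered `e` halts on input 0.
  have hpart : Nat.Partrec fun e => Nat.Partrec.Code.eval (Denumerable.ofNat _ e) 0 :=
    Partrec.nat_iff.1 (Nat.Partrec.Code.eval_part.comp (Computable.ofNat _) (Computable.const 0))
  obtain ⟨P, g, hg, hP⟩ := PairProg.exists_prog_of_partrec hpart
  obtain ⟨M, hM⟩ := exists_of_auto (P.toAuto 0)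
  refine ⟨M, g, hg, ?_⟩
  rintro ⟨f, hf, h⟩
  refine ComputablePred.halting_problem 0 (ComputablePred.computable_iff.2
    ⟨fun c => f (Encodable.encode c), hf.comp Computable.encode, funext fun c => propext ?_⟩)
  have hε : ∀ d e, pairStep 0 d e ↔ e = d := by
    simp [pairStep, letterKind, Kind.eff, Prod.ext_iff]
  have key := hP (Encodable.encode c)
  rw [Denumerable.ofNat_encode] at key
  rw [← key, h, hM]
  exact exists_congr fun q => (Prog.run_toAuto hε P _ q).symm
end Machine

/-! Networks of three one-clock automata that simulate a two-counter machine. The values of the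
counters are the time differences between the middle automaton and the two others. -/

/-- A wiring of three automata: one in the middle, which has a channel to or from each of the two
leaves. -/
structure Wiring where
  mid : Fin 3
  leaf : Bool → Fin 3
  out : Bool → Bool
  leaf_inj : Function.Injective leaf
  leaf_ne : ∀ s, leaf s ≠ mid

/-- The channel between the middle automaton and the leaf `s`; it starts in the middle if and only
if `out s` is true. -/
def Wiring.edge (W : Wiring) (s : Bool) : Fin 3 × Fin 3 :=
  if W.out s = true then (W.mid, W.leaf s) else (W.leaf s, W.mid)

theorem Wiring.cases (W : Wiring) (i : Fin 3) : i = W.mid ∨ ∃ s, i = W.leaf s := by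
  have h := W.leaf_ne false
  have h' := W.leaf_ne true
  have h'' : W.leaf false ≠ W.leaf true := fun h => by simpa using W.leaf_inj h
  by_contra! hi
  have := hi.2 false
  have := hi.2 true
  omega

/-- Ages at which a letter may be read: tests for zero want age zero. -/
def readInterval : Kind → AgeInterval
  | .zero => ⟨0, true, some 0, true⟩
  | _ => ⟨0, true, none, true⟩

theorem readInterval_mem (k : Kind) (t : ℕ) : (readInterval k).Mem t ↔ (k = .zero → t = 0) := by
  cases k <;> simp [readInterval, AgeInterval.Mem]

/-- Exchange of letter `ℓ` with automaton `j`: sent if `o` is true, received otherwise. -/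
def commOp (o : Bool) (j : Fin 3) (ℓ : ℕ) (k : Kind) : ChanOp 3 :=
  if o = true then .write j ℓ else .read j ℓ (readInterval k)

/-- The time that a leaf waits after a letter. -/
def leafGap : Bool → Kind → ℕ
  | true, .inc => 3
  | true, .dec => 1
  | false, .inc => 1
  | false, .dec => 3
  | _, _ => 2

/-- The time of the first letter of a leaf. -/
def leafStart (N : ℕ) : Bool → Bool → ℕ
  | true, false => 2 * N + 1
  | false, false => 1
  | _, true => N + 1

/-- The location of a leaf after a letter. -/
def leafNext (o s : Bool) (ℓ : ℕ) : ℕ := if ℓ / 8 = 1 then 0 else leafGap o (kindOf s ℓ)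

/-- The time spent in a location of a leaf. -/
def leafWait (N : ℕ) (o s : Bool) (q : ℕ) : ℕ := if q = 4 then leafStart N o s else q

/-- The time spent in a state of the middle automaton. -/
def midWait (N q : ℕ) : ℕ := if q = 0 then N + 1 else 2

/-- A transition that is taken when the clock shows `c`, and resets the clock. -/
def timedTrans (src c : ℕ) (op : ChanOp 3) (tgt : ℕ) : Transition 3 1 :=
  ⟨src, [(0, .eq, c)], op, [0], tgt⟩

/-- A transition that resets the clock. -/
def resetLoop (q : ℕ) : Transition 3 1 := ⟨q, [], .nop, [0], q⟩

namespace Machine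

variable (M : Machine) (W : Wiring) (N : ℕ)

/-- The leaf `s`: location `4` is initial, `0` is final, and `1`, `2`, `3` stand for the time to
wait. -/
def leafAut (s : Bool) : TimedAut 3 1 where
  numLocs := 5
  init := 4
  trans := resetLoop 0 ::
    (([1, 2, 3, 4] : List ℕ) ×ˢ List.range (8 * M.numStates)).map fun p =>
      timedTrans p.1 (leafWait N (W.out s) s p.1) (commOp (!W.out s) W.mid p.2 (kindOf s p.2))
        (leafNext (W.out s) s p.2)

/-- The middle automaton, which controls the simulation. -/
def midAut : TimedAut 3 1 where
  numLocs := 9 * M.numStates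
  init := 0
  trans := resetLoop 1 ::
    (M.edges.map (fun p => timedTrans p.1 (midWait N p.1)
      (commOp (W.out false) (W.leaf false) p.2 (kindOf false p.2)) (M.numStates + p.2)) ++
    M.edges.map (fun p => timedTrans (M.numStates + p.2) 0
      (commOp (W.out true) (W.leaf true) p.2 (kindOf true p.2)) (p.2 / 8)))

/-- The network that simulates the machine from counter values `N` and `0`. -/
def net : CTA 3 1 where
  automata i := if i = W.mid then M.midAut W N else M.leafAut W N (decide (i = W.leaf true))
  channels := [W.edge false, W.edge true]
  numMsgs := 8 * M.numStates

theorem net_mid : (M.net W N).automata W.mid = M.midAut W N := if_pos rfl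

theorem net_leaf (s : Bool) : (M.net W N).automata (W.leaf s) = M.leafAut W N s := by
  simp only [net, if_neg (W.leaf_ne s), W.leaf_inj.eq_iff]
  cases s <;> rfl

variable {M W N}

theorem mem_leafAut {s : Bool} {e : Transition 3 1} : e ∈ (M.leafAut W N s).trans ↔
    e = resetLoop 0 ∨ ∃ q ℓ, q ≠ 0 ∧ q ≤ 4 ∧ ℓ < 8 * M.numStates ∧
      e = timedTrans q (leafWait N (W.out s) s q) (commOp (!W.out s) W.mid ℓ (kindOf s ℓ))
        (leafNext (W.out s) s ℓ) := by
  simp only [leafAut, List.mem_cons, List.mem_map, Prod.exists, List.mem_product, List.mem_range]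
  refine or_congr_right ⟨?_, ?_⟩
  · rintro ⟨q, ℓ, ⟨h1, h2⟩, rfl⟩
    simp only [List.not_mem_nil, or_false] at h1
    exact ⟨q, ℓ, by omega, by omega, h2, rfl⟩
  · rintro ⟨q, ℓ, h1, h2, h3, rfl⟩
    exact ⟨q, ℓ, ⟨by simp only [List.not_mem_nil, or_false]; omega, h3⟩, rfl⟩

theorem mem_midAut {e : Transition 3 1} : e ∈ (M.midAut W N).trans ↔ e = resetLoop 1 ∨
    (∃ q ℓ, (q, ℓ) ∈ M.edges ∧ e = timedTrans q (midWait N q)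
      (commOp (W.out false) (W.leaf false) ℓ (kindOf false ℓ)) (M.numStates + ℓ)) ∨
    ∃ q ℓ, (q, ℓ) ∈ M.edges ∧ e = timedTrans (M.numStates + ℓ) 0
      (commOp (W.out true) (W.leaf true) ℓ (kindOf true ℓ)) (ℓ / 8) := by
  simp [midAut, eq_comm]

theorem letter_lt {q ℓ : ℕ} (h : (q, ℓ) ∈ M.edges) : ℓ < 8 * M.numStates := by
  have := M.tgt_lt _ h
  simp only [] at this
  omega

theorem leafNext_le (o s : Bool) (ℓ : ℕ) : leafNext o s ℓ < 4 := by
  unfold leafNext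
  split_ifs
  · omega
  · cases o <;> cases kindOf s ℓ <;> simp [leafGap]

end Machine

theorem leafGap_pos (o : Bool) (k : Kind) : 0 < leafGap o k := by
  cases o <;> cases k <;> simp [leafGap]

theorem leafGap_le (o : Bool) (k : Kind) : leafGap o k ≤ 3 := by
  cases o <;> cases k <;> simp [leafGap]

/-! ### The steps of a network -/

/-- The effect of an operation of automaton `i` on the channels. -/
def ChanEffect {n : ℕ} (i : Fin n) (c c' : Fin n → Fin n → List (ℕ × ℕ)) : ChanOp n → Prop
  | .nop => c' = c
  | .write j a => c' = Function.update c i (Function.update (c i) j ((a, 0) :: c i j))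
  | .read j a I => ∃ w t, c j i = w ++ [(a, t)] ∧ I.Mem t ∧
      c' = Function.update c j (Function.update (c j) i w)

/-- All discrete steps take a common form, with the operation confined to `ChanEffect`; the
invariant then needs no separate treatment of reading and writing. -/
theorem CTA.step_iff {n k : ℕ} {N : CTA n k} {γ γ' : CTAConfig n k} : N.Step γ γ' ↔
    (∃ t, γ' = γ.elapse t) ∨ ∃ i e c, N.Enabled γ i e ∧ ChanEffect i γ.chan c e.op ∧
      γ' = ⟨(γ.move i e).loc, (γ.move i e).val, c⟩ := by
  constructor
  · intro h
    cases h with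
    | time t => exact .inl ⟨t, rfl⟩
    | nop i e h hop => exact .inr ⟨i, e, _, h, by rw [hop]; rfl, rfl⟩
    | write i j a e h hop => exact .inr ⟨i, e, _, h, by rw [hop]; rfl, rfl⟩
    | read i j a I e w t h hop hw ht =>
      exact .inr ⟨i, e, _, h, by rw [hop]; exact ⟨w, t, hw, ht, rfl⟩, rfl⟩
  · rintro (⟨t, rfl⟩ | ⟨i, e, c, h, hop, rfl⟩)
    · exact .time γ t
    · cases he : e.op with
      | nop =>
        rw [he] at hop
        obtain rfl : c = γ.chan := hop
        exact .nop γ i e h he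
      | write j a =>
        rw [he] at hop
        obtain rfl := hop
        exact .write γ i j a e h he
      | read j a I =>
        rw [he] at hop
        obtain ⟨w, t, hw, ht, rfl⟩ := hop
        exact .read γ i j a I e w t h he hw ht

theorem ChanEffect.commOp_of_ne {i j : Fin 3} {c c' : Fin 3 → Fin 3 → List (ℕ × ℕ)} {o : Bool}
    {ℓ : ℕ} {k : Kind} (h : ChanEffect i c c' (commOp o j ℓ k)) {i' j' : Fin 3}
    (hne : (i', j') ≠ if o = true then (i, j) else (j, i)) : c' i' j' = c i' j' := by
  cases o
  · obtain ⟨w, t, -, -, rfl⟩ := h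
    simp only [Bool.false_eq_true, if_false, ne_eq, Prod.mk.injEq, not_and] at hne
    by_cases hi : i' = j
    · subst hi
      rw [Function.update_self, Function.update_of_ne (hne rfl)]
    · rw [Function.update_of_ne hi]
  · obtain rfl := h
    simp only [if_true, ne_eq, Prod.mk.injEq, not_and] at hne
    by_cases hi : i' = i
    · subst hi
      rw [Function.update_self, Function.update_of_ne (hne rfl)]
    · rw [Function.update_of_ne hi]

theorem sat_timedTrans {src c tgt : ℕ} {op : ChanOp 3} {ν : Fin 1 → ℕ} :
    (timedTrans src c op tgt).guard.Sat ν ↔ ν 0 = c := by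
  simp [timedTrans, Guard.Sat, Cmp.Holds]

/-! ### Histories of automata and channels -/

/-- The time of the next letter after the word `w`, if the first one is exchanged at time `st` and
`gap ℓ` time passes after each letter `ℓ`. -/
def nextAt (st : ℕ) (gap : ℕ → ℕ) : List ℕ → ℕ
  | [] => st
  | ℓ :: w => nextAt st gap w + gap ℓ

/-- The time of the latest letter, if `t` gives the times of letters. -/
def lastAt (t : List ℕ → ℕ) : List ℕ → ℕ
  | [] => 0
  | _ :: w => t w

/-- The times of the letters in the middle automaton. -/
abbrev midAt (N : ℕ) : List ℕ → ℕ := nextAt (N + 1) fun _ => 2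

/-- The times of the letters in the leaf `s`. -/
abbrev leafAt (N : ℕ) (o s : Bool) : List ℕ → ℕ :=
  nextAt (leafStart N o s) fun ℓ => leafGap o (kindOf s ℓ)

/-- The location of a leaf after a word. -/
def leafLoc (o s : Bool) : List ℕ → ℕ
  | [] => 4
  | ℓ :: _ => leafNext o s ℓ

/-- Turns the clock guard of a leaf into an equation for the time of its next letter. The final
location is excluded because nothing is exchanged there any more. -/
theorem leafAt_eq {N : ℕ} {o s : Bool} {w : List ℕ} (h : leafLoc o s w ≠ 0) :
    leafAt N o s w = lastAt (leafAt N o s) w + leafWait N o s (leafLoc o s w) := by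
  cases w with
  | nil => simp [nextAt, lastAt, leafWait, leafLoc]
  | cons ℓ w =>
    simp only [leafLoc, leafNext] at h ⊢
    -- Gaps are at most 3, so location `4`, with its special waiting time, is never met after a
    -- letter.
    have := leafGap_le o (kindOf s ℓ)
    split_ifs at h ⊢ with h1
    · simp at h
    · simp only [nextAt, lastAt, leafWait]
      rw [if_neg (by omega)]

theorem Machine.midAt_eq {M : Machine} {N : ℕ} {w : List ℕ} (h : M.Valid w) :
    midAt N w = lastAt (midAt N) w + midWait N (stateAfter w) := by
  cases w with
  | nil => simp [nextAt, lastAt, midWait, stateAfter]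
  | cons ℓ w =>
    have := M.tgt_ne _ h.1
    rw [midWait, if_neg (show stateAfter (ℓ :: w) ≠ 0 from this)]
    rfl

/-- All letters of the word were exchanged before or at the time `now`. -/
def Past (t : List ℕ → ℕ) (now : ℕ) : List ℕ → Prop
  | [] => True
  | _ :: w => t w ≤ now ∧ Past t now w

/-- The letters `r`, written after the word `w`, with their ages. -/
def pending (t : List ℕ → ℕ) (now : ℕ) : List ℕ → List ℕ → List (ℕ × ℕ)
  | [], _ => []
  | ℓ :: r, w => (ℓ, now - t (r ++ w)) :: pending t now r w

/-- Each letter of the word is read (at the time given by `tv`) after it was written (at the time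
given by `tu`), and immediately if it tests for zero. -/
def Timely (k : ℕ → Kind) (tu tv : List ℕ → ℕ) : List ℕ → Prop
  | [] => True
  | ℓ :: w => (tu w ≤ tv w ∧ (k ℓ = .zero → tv w = tu w)) ∧ Timely k tu tv w

theorem Past.of_append {t : List ℕ → ℕ} {now : ℕ} {r w : List ℕ} (h : Past t now (r ++ w)) :
    Past t now w := by
  induction r with
  | nil => exact h
  | cons ℓ r ih => exact ih h.2

theorem Past.mono {t : List ℕ → ℕ} {now now' : ℕ} {w : List ℕ} (h : Past t now w)
    (hn : now ≤ now') : Past t now' w := by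
  induction w with
  | nil => trivial
  | cons ℓ w ih => exact ⟨h.1.trans hn, ih h.2⟩

theorem Timely.of_append {k : ℕ → Kind} {tu tv : List ℕ → ℕ} {r w : List ℕ}
    (h : Timely k tu tv (r ++ w)) : Timely k tu tv w := by
  induction r with
  | nil => exact h
  | cons ℓ r ih => exact ih h.2

/-- All writing times lie in the past, so the truncated subtraction in the ages is a true one. -/
theorem pending_elapse {t : List ℕ → ℕ} {now : ℕ} {r w : List ℕ} (h : Past t now (r ++ w))
    (d : ℕ) : pending t (now + d) r w = (pending t now r w).map fun p => (p.1, p.2 + d) := by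
  induction r with
  | nil => rfl
  | cons ℓ r ih =>
    have : t (r ++ w) ≤ now := h.1
    simp only [pending, List.map_cons, ih h.2]
    congr 2
    omega

/-- Words and channels list the newest letter first; the letter due to be read is the one written
right after `w`, at the far end. -/
theorem pending_append (t : List ℕ → ℕ) (now ℓ : ℕ) (r w : List ℕ) :
    pending t now (r ++ [ℓ]) w = pending t now r (ℓ :: w) ++ [(ℓ, now - t w)] := by
  induction r with
  | nil => rfl
  | cons ℓ' r ih => simp [pending, ih]

/-- The state of a channel with content `c`, if the word `wu` has been written and `wv` has been
read. -/
def ChanInv (k : ℕ → Kind) (now : ℕ) (tu tv : List ℕ → ℕ) (wu wv : List ℕ) (c : List (ℕ × ℕ)) :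
    Prop :=
  ∃ r, wu = r ++ wv ∧ c = pending tu now r wv ∧ Past tu now wu ∧ Timely k tu tv wv

namespace ChanInv

variable {k : ℕ → Kind} {now : ℕ} {tu tv : List ℕ → ℕ} {wu wv : List ℕ} {c : List (ℕ × ℕ)}

theorem elapse (h : ChanInv k now tu tv wu wv c) (d : ℕ) :
    ChanInv k (now + d) tu tv wu wv (c.map fun p => (p.1, p.2 + d)) := by
  obtain ⟨r, rfl, rfl, h1, h2⟩ := h
  exact ⟨r, rfl, (pending_elapse h1 d).symm, h1.mono (by omega), h2⟩

theorem write (h : ChanInv k now tu tv wu wv c) (hu : tu wu = now) (ℓ : ℕ) :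
    ChanInv k now tu tv (ℓ :: wu) wv ((ℓ, 0) :: c) := by
  obtain ⟨r, rfl, rfl, h1, h2⟩ := h
  refine ⟨ℓ :: r, rfl, ?_, ⟨hu.le, h1⟩, h2⟩
  rw [pending, hu, Nat.sub_self]

/-- The unread word must end in the letter that is read, and its age is `now - tu wv`. Age zero
therefore means equality of writing and reading time, which is what `Timely` records. -/
theorem read {ℓ t : ℕ} (h : ChanInv k now tu tv wu wv (c ++ [(ℓ, t)])) (hv : tv wv = now)
    (ht : (readInterval (k ℓ)).Mem t) : ChanInv k now tu tv wu (ℓ :: wv) c := by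
  obtain ⟨r, rfl, hc, h1, h2⟩ := h
  rcases r.eq_nil_or_concat with rfl | ⟨r, ℓ', rfl⟩
  · simp [pending] at hc
  · rw [List.concat_eq_append, pending_append] at hc
    obtain ⟨rfl, h3⟩ := List.append_inj' hc rfl
    simp only [List.cons.injEq, Prod.mk.injEq, and_true] at h3
    obtain ⟨rfl, rfl⟩ := h3
    simp only [List.concat_eq_append, List.append_assoc, List.singleton_append] at h1 ⊢
    have h4 := h1.of_append.1
    refine ⟨r, rfl, rfl, h1, ⟨by omega, fun hk => ?_⟩, h2⟩
    have := (readInterval_mem _ _).1 ht hk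
    omega

theorem exists_read {ℓ : ℕ} {r : List ℕ} (h : ChanInv k now tu tv wu wv c)
    (hr : wu = r ++ ℓ :: wv) : ∃ c', c = c' ++ [(ℓ, now - tu wv)] := by
  obtain ⟨r', rfl, rfl, -, -⟩ := h
  obtain rfl : r' = r ++ [ℓ] := by
    rw [List.append_cons] at hr
    exact List.append_cancel_right hr
  exact ⟨_, pending_append _ _ _ _ _⟩

end ChanInv

/-- The state of the channel between automata `i` and `j`, if `wi` and `wj` are the words of
letters that they have exchanged with each other; the channel starts in `i` if `o` is true. -/
def LinkInv (k : ℕ → Kind) (now : ℕ) (c : Fin 3 → Fin 3 → List (ℕ × ℕ)) (o : Bool) (i j : Fin 3)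
    (ti tj : List ℕ → ℕ) (wi wj : List ℕ) : Prop :=
  if o = true then ChanInv k now ti tj wi wj (c i j) else ChanInv k now tj ti wj wi (c j i)

namespace LinkInv

variable {k : ℕ → Kind} {now : ℕ} {c c' : Fin 3 → Fin 3 → List (ℕ × ℕ)} {o : Bool} {i j : Fin 3}
  {ti tj : List ℕ → ℕ} {wi wj : List ℕ}

/-- Exchanging the ends of a link flips its direction, so statements about the first end serve for
the middle and for the leaves alike. -/
theorem symm_iff : LinkInv k now c (!o) j i tj ti wj wi ↔ LinkInv k now c o i j ti tj wi wj := by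
  cases o <;> rfl

theorem comm (h : LinkInv k now c o i j ti tj wi wj) {ℓ : ℕ} (ht : ti wi = now)
    (hc : ChanEffect i c c' (commOp o j ℓ (k ℓ))) : LinkInv k now c' o i j ti tj (ℓ :: wi) wj := by
  cases o
  · obtain ⟨w, t, hw, ht', rfl⟩ := hc
    simp only [LinkInv, Bool.false_eq_true, if_false, Function.update_self] at h ⊢
    rw [hw] at h
    exact h.read ht ht'
  · obtain rfl := hc
    simp only [LinkInv, if_true, Function.update_self] at h ⊢
    exact h.write ht ℓ

theorem exists_chanEffect (h : LinkInv k now c o i j ti tj wi wj) {ℓ : ℕ} (ht : ti wi = now)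
    (hr : o = false → (∃ r, wj = r ++ ℓ :: wi) ∧ (k ℓ = .zero → ti wi = tj wi)) :
    ∃ c', ChanEffect i c c' (commOp o j ℓ (k ℓ)) := by
  cases o
  · obtain ⟨⟨r, hr⟩, hz⟩ := hr rfl
    simp only [LinkInv, Bool.false_eq_true, if_false] at h
    obtain ⟨w, hw⟩ := h.exists_read hr
    refine ⟨_, w, _, hw, (readInterval_mem _ _).2 fun hk => ?_, rfl⟩
    have := hz hk
    omega
  · exact ⟨_, rfl⟩

theorem congr (h : LinkInv k now c o i j ti tj wi wj)
    (hc : ∀ i' j', (i', j') = (if o = true then (i, j) else (j, i)) → c' i' j' = c i' j') :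
    LinkInv k now c' o i j ti tj wi wj := by
  cases o
  · simp only [LinkInv, Bool.false_eq_true, if_false] at h hc ⊢
    rwa [hc j i rfl]
  · simp only [LinkInv, if_true] at h hc ⊢
    rwa [hc i j rfl]

end LinkInv

theorem Wiring.edge_ne (W : Wiring) {s s' : Bool} (h : s' ≠ s) : W.edge s' ≠ W.edge s := by
  have h1 := W.leaf_ne s
  have h2 := W.leaf_ne s'
  have h3 : W.leaf s' ≠ W.leaf s := fun e => h (W.leaf_inj e)
  unfold edge
  split_ifs <;> simp [h2, h3, h1.symm]

theorem Wiring.edge_eq_not (W : Wiring) (s : Bool) :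
    W.edge s = if (!W.out s) = true then (W.leaf s, W.mid) else (W.mid, W.leaf s) := by
  unfold edge
  cases W.out s <;> rfl

/-! ### The invariant of reachable configurations. -/

namespace Machine

variable {M : Machine} {W : Wiring} {N : ℕ}

/-- The state of the middle automaton with location `q` and clock `x`, after the words `wm s`
exchanged with the leaves `s`. -/
def MidInv (M : Machine) (N now q x : ℕ) (wm : Bool → List ℕ) : Prop :=
  (∃ w, (wm = fun _ => w) ∧ M.Valid w ∧ q = stateAfter w ∧
    (stateAfter w ≠ 1 → now = x + lastAt (midAt N) w)) ∨
  ∃ ℓ w, (wm = fun s => if s = true then w else ℓ :: w) ∧ M.Valid (ℓ :: w) ∧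
    q = M.numStates + ℓ ∧ now = x + midAt N w

/-- The configuration of the network at time `now`, after the words `wm s` and `wl s` have been
exchanged between the middle automaton and the leaf `s`. -/
structure Inv (M : Machine) (W : Wiring) (N : ℕ) (γ : CTAConfig 3 1) (now : ℕ)
    (wm wl : Bool → List ℕ) : Prop where
  leaf_loc : ∀ s, γ.loc (W.leaf s) = leafLoc (W.out s) s (wl s)
  leaf_clock : ∀ s, leafLoc (W.out s) s (wl s) ≠ 0 →
    now = γ.val (W.leaf s) 0 + lastAt (leafAt N (W.out s) s) (wl s)
  leaf_tail : ∀ s, ∀ ℓ ∈ (wl s).tail, ℓ / 8 ≠ 1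
  mid : M.MidInv N now (γ.loc W.mid) (γ.val W.mid 0) wm
  link : ∀ s, LinkInv (kindOf s) now γ.chan (W.out s) W.mid (W.leaf s) (midAt N)
    (leafAt N (W.out s) s) (wm s) (wl s)
  other : ∀ i j, (∀ s, (i, j) ≠ W.edge s) → γ.chan i j = []

theorem Inv.initial : M.Inv W N (M.net W N).initial 0 (fun _ => []) fun _ => [] where
  leaf_loc s := by simp [CTA.initial, net_leaf, leafAut, leafLoc]
  leaf_clock s _ := rfl
  leaf_tail s := by simp
  mid := .inl ⟨[], rfl, trivial, by simp [CTA.initial, net_mid, midAut, stateAfter], fun _ => rfl⟩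
  link s := by
    unfold LinkInv
    split_ifs <;> exact ⟨[], rfl, rfl, trivial, trivial⟩
  other _ _ _ := rfl

theorem Inv.elapse {γ : CTAConfig 3 1} {now : ℕ} {wm wl : Bool → List ℕ}
    (h : M.Inv W N γ now wm wl) (t : ℕ) : M.Inv W N (γ.elapse t) (now + t) wm wl where
  leaf_loc := h.leaf_loc
  leaf_clock s hs := by
    have := h.leaf_clock s hs
    simp only [CTAConfig.elapse]
    omega
  leaf_tail := h.leaf_tail
  mid := by
    rcases h.mid with ⟨w, h1, h2, h3, h4⟩ | ⟨ℓ, w, h1, h2, h3, h4⟩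
    · refine .inl ⟨w, h1, h2, h3, fun h5 => ?_⟩
      have := h4 h5
      simp only [CTAConfig.elapse]
      omega
    · refine .inr ⟨ℓ, w, h1, h2, h3, ?_⟩
      simp only [CTAConfig.elapse]
      omega
  link s := by
    have := h.link s
    unfold LinkInv at this ⊢
    split_ifs at this ⊢ <;> exact ChanInv.elapse this t
  other i j hij := by simp [CTAConfig.elapse, h.other i j hij]

theorem Inv.leaf_event {γ γ' : CTAConfig 3 1} {now : ℕ} {wm wl : Bool → List ℕ}
    (h : M.Inv W N γ now wm wl) {s : Bool} {ℓ : ℕ} {v : Fin 1 → ℕ}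
    (hs : leafLoc (W.out s) s (wl s) ≠ 0) (ht : leafAt N (W.out s) s (wl s) = now)
    (hloc : γ'.loc = Function.update γ.loc (W.leaf s) (leafNext (W.out s) s ℓ))
    (hval : γ'.val = Function.update γ.val (W.leaf s) v) (hv : v 0 = 0)
    (hc : ChanEffect (W.leaf s) γ.chan γ'.chan (commOp (!W.out s) W.mid ℓ (kindOf s ℓ))) :
    M.Inv W N γ' now wm (Function.update wl s (ℓ :: wl s)) where
  leaf_loc s' := by
    rw [hloc]
    by_cases hs' : s' = s
    · subst hs'
      simp [leafLoc]
    · rw [Function.update_of_ne (fun e => hs' (W.leaf_inj e)), Function.update_of_ne hs', h.leaf_loc]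
  leaf_clock s' h' := by
    rw [hval]
    by_cases hs' : s' = s
    · subst hs'
      simp only [Function.update_self, lastAt]
      omega
    · rw [Function.update_of_ne hs'] at h' ⊢
      rw [Function.update_of_ne (fun e => hs' (W.leaf_inj e))]
      exact h.leaf_clock s' h'
  leaf_tail s' := by
    by_cases hs' : s' = s
    · subst hs'
      rw [Function.update_self, List.tail_cons]
      intro a ha
      cases hw : wl s' with
      | nil => rw [hw] at ha; cases ha
      | cons b w =>
        rw [hw] at ha
        rcases List.mem_cons.1 ha with rfl | ha
        · rw [hw] at hs
          intro h1
          simp [leafLoc, leafNext, h1] at hs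
        · exact h.leaf_tail s' a (by rw [hw]; exact ha)
    · rw [Function.update_of_ne hs']
      exact h.leaf_tail s'
  mid := by
    rw [hloc, hval, Function.update_of_ne (W.leaf_ne s).symm, Function.update_of_ne (W.leaf_ne s).symm]
    exact h.mid
  link s' := by
    by_cases hs' : s' = s
    · subst hs'
      rw [Function.update_self]
      exact LinkInv.symm_iff.1 ((LinkInv.symm_iff.2 (h.link s')).comm ht hc)
    · rw [Function.update_of_ne hs']
      refine (h.link s').congr fun i j hij => hc.commOp_of_ne ?_
      rw [← W.edge_eq_not, hij]
      exact W.edge_ne hs'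
  other i j hij := by
    rw [hc.commOp_of_ne (by rw [← W.edge_eq_not]; exact hij s)]
    exact h.other i j hij

theorem Inv.of_update_mid {γ γ' : CTAConfig 3 1} {now : ℕ} {wm wm' wl : Bool → List ℕ}
    (h : M.Inv W N γ now wm wl) {s : Bool} {ℓ q : ℕ} {v : Fin 1 → ℕ}
    (ht : midAt N (wm s) = now) (hws : wm' s = ℓ :: wm s) (hw : ∀ s', s' ≠ s → wm' s' = wm s')
    (hloc : γ'.loc = Function.update γ.loc W.mid q) (hval : γ'.val = Function.update γ.val W.mid v)
    (hmid : M.MidInv N now q (v 0) wm')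
    (hc : ChanEffect W.mid γ.chan γ'.chan (commOp (W.out s) (W.leaf s) ℓ (kindOf s ℓ))) :
    M.Inv W N γ' now wm' wl where
  leaf_loc s' := by
    rw [hloc, Function.update_of_ne (W.leaf_ne _), h.leaf_loc]
  leaf_clock s' h' := by
    rw [hval, Function.update_of_ne (W.leaf_ne _)]
    exact h.leaf_clock s' h'
  leaf_tail := h.leaf_tail
  mid := by
    rw [hloc, hval, Function.update_self, Function.update_self]
    exact hmid
  link s' := by
    by_cases hs' : s' = s
    · subst hs'
      rw [hws]
      exact (h.link s').comm ht hc
    · rw [hw s' hs']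
      refine (h.link s').congr fun i j hij => hc.commOp_of_ne ?_
      rw [hij]
      exact W.edge_ne hs'
  other i j hij := by
    rw [hc.commOp_of_ne (hij s)]
    exact h.other i j hij

theorem Inv.valid {γ : CTAConfig 3 1} {now : ℕ} {w : List ℕ} {wl : Bool → List ℕ}
    (h : M.Inv W N γ now (fun _ => w) wl) : M.Valid w ∧ γ.loc W.mid = stateAfter w ∧
      (stateAfter w ≠ 1 → now = γ.val W.mid 0 + lastAt (midAt N) w) := by
  rcases h.mid with ⟨w', h1, h2, h3, h4⟩ | ⟨ℓ, w', h1, h2, h3, h4⟩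
  · obtain rfl : w = w' := congrFun h1 true
    exact ⟨h2, h3, h4⟩
  · have h5 := congrFun h1 true
    have h6 := congrFun h1 false
    simp only [if_true, Bool.false_eq_true, if_false] at h5 h6
    rw [h5] at h6
    -- Between its two exchanges of a letter the middle has words of different lengths with the two
    -- leaves.
    exact absurd (congrArg List.length h6) (by simp)

theorem Inv.mid_event_false {γ γ' : CTAConfig 3 1} {now : ℕ} {w : List ℕ} {wl : Bool → List ℕ}
    (h : M.Inv W N γ now (fun _ => w) wl) {ℓ : ℕ} {v : Fin 1 → ℕ}
    (he : (stateAfter w, ℓ) ∈ M.edges) (ht : midAt N w = now)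
    (hloc : γ'.loc = Function.update γ.loc W.mid (M.numStates + ℓ))
    (hval : γ'.val = Function.update γ.val W.mid v) (hv : v 0 = 0)
    (hc : ChanEffect W.mid γ.chan γ'.chan
      (commOp (W.out false) (W.leaf false) ℓ (kindOf false ℓ))) :
    M.Inv W N γ' now (fun s => if s = true then w else ℓ :: w) wl :=
  h.of_update_mid (s := false) ht rfl (by simp) hloc hval
    (.inr ⟨ℓ, w, rfl, ⟨he, h.valid.1⟩, rfl, by omega⟩) hc

theorem Inv.mid_event_true {γ γ' : CTAConfig 3 1} {now : ℕ} {w : List ℕ} {wl : Bool → List ℕ}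
    {ℓ : ℕ} (h : M.Inv W N γ now (fun s => if s = true then w else ℓ :: w) wl) {v : Fin 1 → ℕ}
    (he : M.Valid (ℓ :: w)) (ht : midAt N w = now)
    (hloc : γ'.loc = Function.update γ.loc W.mid (ℓ / 8))
    (hval : γ'.val = Function.update γ.val W.mid v) (hv : v 0 = 0)
    (hc : ChanEffect W.mid γ.chan γ'.chan
      (commOp (W.out true) (W.leaf true) ℓ (kindOf true ℓ))) :
    M.Inv W N γ' now (fun _ => ℓ :: w) wl :=
  h.of_update_mid (s := true) ht rfl (by simp) hloc hval
    (.inl ⟨ℓ :: w, rfl, he, rfl, fun _ => by simp only [lastAt]; omega⟩) hc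

/-- The invariant does not track the clock of a leaf in its final location, so it may be reset there
freely. -/
theorem Inv.reset_leaf {γ γ' : CTAConfig 3 1} {now : ℕ} {wm wl : Bool → List ℕ}
    (h : M.Inv W N γ now wm wl) {s : Bool} (hs : leafLoc (W.out s) s (wl s) = 0) {v : Fin 1 → ℕ}
    (hloc : γ'.loc = γ.loc) (hval : γ'.val = Function.update γ.val (W.leaf s) v)
    (hc : γ'.chan = γ.chan) : M.Inv W N γ' now wm wl where
  leaf_loc := by rw [hloc]; exact h.leaf_loc
  leaf_clock s' h' := by
    by_cases hs' : s' = s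
    · subst hs'
      exact absurd hs h'
    · rw [hval, Function.update_of_ne (fun e => hs' (W.leaf_inj e))]
      exact h.leaf_clock s' h'
  leaf_tail := h.leaf_tail
  mid := by
    rw [hloc, hval, Function.update_of_ne (W.leaf_ne s).symm]
    exact h.mid
  link := by rw [hc]; exact h.link
  other := by rw [hc]; exact h.other

theorem Inv.reset_mid {γ γ' : CTAConfig 3 1} {now : ℕ} {wm wl : Bool → List ℕ}
    (h : M.Inv W N γ now wm wl) (h1 : γ.loc W.mid = 1) {v : Fin 1 → ℕ}
    (hloc : γ'.loc = γ.loc) (hval : γ'.val = Function.update γ.val W.mid v)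
    (hc : γ'.chan = γ.chan) : M.Inv W N γ' now wm wl where
  leaf_loc := by rw [hloc]; exact h.leaf_loc
  leaf_clock s' h' := by
    rw [hval, Function.update_of_ne (W.leaf_ne _)]
    exact h.leaf_clock s' h'
  leaf_tail := h.leaf_tail
  mid := by
    rw [hloc]
    rcases h.mid with ⟨w, h2, h3, h4, h5⟩ | ⟨ℓ, w, h2, h3, h4, h5⟩
    · exact .inl ⟨w, h2, h3, h4, fun h6 => absurd (h4.symm.trans h1) h6⟩
    · have := M.two_le
      omega
  link := by rw [hc]; exact h.link
  other := by rw [hc]; exact h.other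

theorem move_resetLoop_loc {γ : CTAConfig 3 1} {i : Fin 3} {q : ℕ} (h : γ.loc i = q) :
    (γ.move i (resetLoop q)).loc = γ.loc := by
  simp [CTAConfig.move, resetLoop, ← h]

/-- The guards are equalities, so together with `midAt_eq` and `leafAt_eq` they force every letter
to be exchanged at its prescribed time. Locations below `M.numStates` are states of the machine;
those from there on stand between the two exchanges of one letter. -/
theorem Inv.step {γ γ' : CTAConfig 3 1} {now : ℕ} {wm wl : Bool → List ℕ}
    (h : M.Inv W N γ now wm wl) (hstep : (M.net W N).Step γ γ') :
    ∃ now' wm' wl', M.Inv W N γ' now' wm' wl' := by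
  rcases CTA.step_iff.1 hstep with ⟨t, rfl⟩ | ⟨i, e, c, ⟨he, hsrc, hsat⟩, hc, rfl⟩
  · exact ⟨_, _, _, h.elapse t⟩
  rcases W.cases i with rfl | ⟨s, rfl⟩
  · rw [net_mid, mem_midAut] at he
    rcases he with rfl | ⟨q, ℓ, hE, rfl⟩ | ⟨q, ℓ, hE, rfl⟩
    · exact ⟨_, _, _, h.reset_mid hsrc (move_resetLoop_loc hsrc) rfl hc⟩
    · rw [sat_timedTrans] at hsat
      simp only [timedTrans] at hsrc hc ⊢
      rcases h.mid with ⟨w, rfl, h2, h3, h4⟩ | ⟨ℓ', w, rfl, h2, h3, h4⟩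
      · have hq : stateAfter w = q := h3.symm.trans hsrc
        have h5 := h4 (by rw [hq]; exact M.src_ne _ hE)
        refine ⟨_, _, _, h.mid_event_false (hq ▸ hE) ?_ rfl rfl (by simp) hc⟩
        rw [midAt_eq h2, hq]
        omega
      · have := M.src_lt _ hE
        simp only [] at this
        omega
    · rw [sat_timedTrans] at hsat
      simp only [timedTrans] at hsrc hc ⊢
      rcases h.mid with ⟨w, rfl, h2, h3, h4⟩ | ⟨ℓ', w, rfl, h2, h3, h4⟩
      · have : stateAfter w < M.numStates := by
          cases w with
          | nil => have := M.two_le; simp only [stateAfter]; omega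
          | cons a w => exact M.tgt_lt _ h2.1
        omega
      · obtain rfl : ℓ = ℓ' := by omega
        exact ⟨_, _, _, h.mid_event_true h2 (by omega) rfl rfl (by simp) hc⟩
  · rw [net_leaf, mem_leafAut] at he
    have hloc := h.leaf_loc s
    rcases he with rfl | ⟨q, ℓ, hq0, hq, hℓ, rfl⟩
    · exact ⟨_, _, _, h.reset_leaf (hloc.symm.trans hsrc) (move_resetLoop_loc hsrc) rfl hc⟩
    · rw [sat_timedTrans] at hsat
      simp only [timedTrans] at hsrc hc ⊢
      have hq1 : leafLoc (W.out s) s (wl s) = q := hloc.symm.trans hsrc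
      have h5 := h.leaf_clock s (by omega)
      refine ⟨_, _, _, h.leaf_event (by omega) ?_ rfl rfl (by simp) hc⟩
      rw [leafAt_eq (by omega), hq1]
      omega

theorem exists_inv {γ : CTAConfig 3 1} (h : (M.net W N).Reaches γ) :
    ∃ now wm wl, M.Inv W N γ now wm wl := by
  induction h with
  | refl => exact ⟨_, _, _, .initial⟩
  | tail _ h2 ih =>
    obtain ⟨_, _, _, h⟩ := ih
    exact h.step h2

end Machine

/-! ### Words that the network can exchange are runs of the machine -/

/-- The initial value of a counter. -/
def initVal (N : ℕ) (s : Bool) : ℕ := if s = true then 0 else N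

/-- The time difference that stands for the value of a counter. -/
def lag (N : ℕ) (o s : Bool) (w : List ℕ) : ℕ :=
  if o = true then leafAt N o s w - midAt N w else midAt N w - leafAt N o s w

/-- The word can be sent through the channel between the middle automaton and leaf `s`. -/
def TimelyLink (N : ℕ) (o s : Bool) (w : List ℕ) : Prop :=
  if o = true then Timely (kindOf s) (midAt N) (leafAt N o s) w
  else Timely (kindOf s) (leafAt N o s) (midAt N) w

theorem lag_nil (N : ℕ) (o s : Bool) : lag N o s [] = initVal N s := by
  cases o <;> cases s <;> simp [lag, nextAt, leafStart, initVal]; omega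

theorem leafAt_cons (N : ℕ) (o s : Bool) (ℓ : ℕ) (w : List ℕ) :
    leafAt N o s (ℓ :: w) = leafAt N o s w + leafGap o (kindOf s ℓ) := rfl

theorem midAt_cons (N ℓ : ℕ) (w : List ℕ) : midAt N (ℓ :: w) = midAt N w + 2 := rfl

/-- The lag changes by the difference of the gaps of leaf and middle, that is by 1, -1 or 0. An
illegal decrement in the newest letter of `w` shows only at the next exchange, where reading would
precede writing; hence the extra letter `ℓ`. -/
theorem exec_of_timelyLink {N : ℕ} {o s : Bool} {ℓ : ℕ} {w : List ℕ}
    (h : TimelyLink N o s (ℓ :: w)) : Exec s (initVal N s) w (lag N o s w) := by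
  induction w generalizing ℓ with
  | nil => exact lag_nil N o s
  | cons a w ih =>
    cases o
    · obtain ⟨⟨h1, -⟩, ⟨h2, h2'⟩, h3⟩ : Timely (kindOf s) (leafAt N false s) (midAt N)
        (ℓ :: a :: w) := h
      refine ⟨_, ih (ℓ := a) (show Timely _ _ _ _ from ⟨⟨h2, h2'⟩, h3⟩), ?_⟩
      simp only [leafAt_cons, midAt_cons, lag, Bool.false_eq_true, if_false] at h1 h2 h2' ⊢
      cases hk : kindOf s a <;> simp only [Kind.eff, hk, leafGap] at h1 h2' ⊢ <;> grind
    · obtain ⟨⟨h1, -⟩, ⟨h2, h2'⟩, h3⟩ : Timely (kindOf s) (midAt N) (leafAt N true s)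
        (ℓ :: a :: w) := h
      refine ⟨_, ih (ℓ := a) (show Timely _ _ _ _ from ⟨⟨h2, h2'⟩, h3⟩), ?_⟩
      simp only [leafAt_cons, midAt_cons, lag, if_true] at h1 h2 h2' ⊢
      cases hk : kindOf s a <;> simp only [Kind.eff, hk, leafGap] at h1 h2' ⊢ <;> grind

/-- The order of the two times is carried through the induction, because `lag` is a truncated
difference and equals the counter only if it does not truncate. -/
theorem timelyLink_of_exec {N : ℕ} {o s : Bool} {w : List ℕ} {c : ℕ}
    (h : Exec s (initVal N s) w c) : TimelyLink N o s w ∧ c = lag N o s w ∧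
      if o = true then midAt N w ≤ leafAt N o s w else leafAt N o s w ≤ midAt N w := by
  induction w generalizing c with
  | nil =>
    obtain rfl : c = initVal N s := h
    refine ⟨by unfold TimelyLink; split_ifs <;> trivial, (lag_nil N o s).symm, ?_⟩
    cases o <;> cases s <;> simp [nextAt, leafStart]; omega
  | cons a w ih =>
    obtain ⟨b, h1, h2⟩ := h
    obtain ⟨h3, rfl, h4⟩ := ih h1
    cases o
    · simp only [leafAt_cons, midAt_cons, TimelyLink, lag, Timely, Bool.false_eq_true, if_false]
        at h2 h3 h4 ⊢
      cases hk : kindOf s a <;> simp only [Kind.eff, hk, leafGap] at h2 ⊢ <;> grind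
    · simp only [leafAt_cons, midAt_cons, TimelyLink, lag, Timely, if_true] at h2 h3 h4 ⊢
      cases hk : kindOf s a <;> simp only [Kind.eff, hk, leafGap] at h2 ⊢ <;> grind

namespace Machine

variable {M : Machine} {W : Wiring} {N : ℕ}

/-- No edge leaves the halting state, so only the newest letter of a path can be a halting one. -/
theorem Valid.not_halt {ℓ : ℕ} {w : List ℕ} (h : M.Valid (ℓ :: w)) : ∀ a ∈ w, a / 8 ≠ 1 := by
  induction w generalizing ℓ with
  | nil => simp
  | cons b w ih =>
    intro a ha
    rcases List.mem_cons.1 ha with rfl | ha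
    · exact M.src_ne _ h.1
    · exact ih h.2 a ha

theorem Valid.of_append {r w : List ℕ} (h : M.Valid (r ++ w)) : M.Valid w := by
  induction r with
  | nil => exact h
  | cons ℓ r ih => exact ih h.2

theorem eq_cons_of_leafLoc {o s : Bool} {w : List ℕ} (h : leafLoc o s w = 0) :
    ∃ ℓ w', w = ℓ :: w' ∧ ℓ / 8 = 1 := by
  cases w with
  | nil => simp [leafLoc] at h
  | cons ℓ w =>
    refine ⟨ℓ, w, rfl, ?_⟩
    by_contra hℓ
    simp only [leafLoc, leafNext, if_neg hℓ] at h
    have := leafGap_pos o (kindOf s ℓ)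
    omega

theorem Valid.eq_nil_of_append {r w : List ℕ} {ℓ : ℕ} (h : M.Valid (r ++ ℓ :: w))
    (hℓ : ℓ / 8 = 1) : r = [] := by
  cases r with
  | nil => rfl
  | cons a r => exact absurd hℓ (h.not_halt ℓ (by simp))

/-- On a channel into the middle, the middle itself has read the whole word. On a channel out of it,
one has to know that the leaf has read everything, which its final location tells. Letters that a
writing leaf has sent in excess are harmless. -/
theorem Inv.halts {γ : CTAConfig 3 1} {now : ℕ} {wm wl : Bool → List ℕ}
    (h : M.Inv W N γ now wm wl) (hm : γ.loc W.mid = 1)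
    (hl : ∀ s, W.out s = true → γ.loc (W.leaf s) = 0) : M.Halts N := by
  rcases h.mid with ⟨w, rfl, h2, h3, -⟩ | ⟨ℓ, w, -, -, h3, -⟩
  · cases w with
    | nil => simp [stateAfter, hm] at h3
    | cons ℓ w =>
      have key : ∀ s, TimelyLink N (W.out s) s (ℓ :: w) := by
        intro s
        have hlink := h.link s
        unfold LinkInv at hlink
        unfold TimelyLink
        split_ifs at hlink ⊢ with ho
        · obtain ⟨r, hr, -, -, hT⟩ := hlink
          obtain ⟨a, w', hw, ha⟩ := eq_cons_of_leafLoc ((h.leaf_loc s).symm.trans (hl s ho))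
          rw [hw] at hr hT
          rw [hr] at h2
          -- The leaf has read a halting letter, and the middle cannot have written anything after
          -- it.
          obtain rfl := h2.eq_nil_of_append ha
          rw [hr]
          exact hT
        · obtain ⟨r, hr, -, -, hT⟩ := hlink
          exact hT
      exact ⟨ℓ, w, h2, h3.symm.trans hm, ⟨_, exec_of_timelyLink (key false)⟩,
        _, exec_of_timelyLink (key true)⟩
  · have := M.two_le
    omega

/-- A leaf that has read a halting letter got it from the middle, which must have been halting when
it sent it. -/
theorem Inv.mid_halted {γ : CTAConfig 3 1} {now : ℕ} {wm wl : Bool → List ℕ}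
    (h : M.Inv W N γ now wm wl) (ho : W.out true = true) (hl : γ.loc (W.leaf true) = 0) :
    γ.loc W.mid = 1 := by
  obtain ⟨a, w', hw, ha⟩ := eq_cons_of_leafLoc ((h.leaf_loc true).symm.trans hl)
  have hlink := h.link true
  unfold LinkInv at hlink
  rw [if_pos ho, hw] at hlink
  obtain ⟨r, hr, -⟩ := hlink
  rcases h.mid with ⟨w, rfl, h2, h3, -⟩ | ⟨ℓ, w, rfl, h2, -, -⟩
  · simp only [] at hr
    rw [hr] at h2
    obtain rfl := h2.eq_nil_of_append ha
    rw [h3, hr]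
    exact ha
  · simp only [if_true] at hr
    exact absurd ha (h2.not_halt a (by rw [hr]; simp))

end Machine

/-! ### Runs of the machine can be simulated -/

/-- The letters of a word that are exchanged up to time `τ`. -/
def cut (t : List ℕ → ℕ) (τ : ℕ) : List ℕ → List ℕ
  | [] => []
  | ℓ :: w => if t w ≤ τ then ℓ :: w else cut t τ w

section Cut

variable {t : List ℕ → ℕ} {τ : ℕ} {w : List ℕ}

theorem cut_suffix : cut t τ w <:+ w := by
  induction w with
  | nil => exact List.suffix_rfl
  | cons ℓ w ih =>
    unfold cut
    split_ifs
    · exact List.suffix_rfl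
    · exact ih.trans (List.suffix_cons ℓ w)

theorem suffix_cut {ℓ : ℕ} {v : List ℕ} (h : ℓ :: v <:+ w) (hv : t v ≤ τ) :
    ℓ :: v <:+ cut t τ w := by
  induction w with
  | nil => simp at h
  | cons a w ih =>
    unfold cut
    split_ifs with ha
    · exact h
    · rcases List.suffix_cons_iff.1 h with h | h
      · cases h; exact absurd hv ha
      · exact ih h

theorem cut_cons_self {ℓ : ℕ} (h : t w ≤ τ) : cut t τ (ℓ :: w) = ℓ :: w := if_pos h

theorem cut_eq_self (ht : ∀ ℓ w, t w < t (ℓ :: w)) (h : t w ≤ τ + 1) : cut t τ w = w := by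
  cases w with
  | nil => rfl
  | cons ℓ w =>
    have := ht ℓ w
    exact cut_cons_self (by omega)

theorem cut_zero (ht : ∀ w, 0 < t w) : cut t 0 w = [] := by
  induction w with
  | nil => rfl
  | cons ℓ w ih =>
    have := ht w
    rw [cut, if_neg (by omega), ih]

/-- Times of letters strictly increase, so an automaton exchanges at most one letter with a given
partner per time unit. -/
theorem cut_succ (ht : ∀ ℓ w, t w < t (ℓ :: w)) : cut t (τ + 1) w = cut t τ w ∨
    ∃ ℓ, cut t (τ + 1) w = ℓ :: cut t τ w ∧ t (cut t τ w) = τ + 1 := by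
  induction w with
  | nil => exact .inl rfl
  | cons ℓ w ih =>
    rcases Nat.lt_trichotomy (t w) (τ + 1) with h | h | h
    · left
      rw [cut_cons_self (by omega), cut_cons_self (by omega)]
    · right
      refine ⟨ℓ, ?_⟩
      rw [cut_cons_self h.le, cut, if_neg (by omega), cut_eq_self ht h.le]
      exact ⟨rfl, h⟩
    · rw [cut, if_neg (by omega), cut, if_neg (by omega)]
      exact ih

end Cut

theorem midAt_lt (N ℓ : ℕ) (w : List ℕ) : midAt N w < midAt N (ℓ :: w) := by
  rw [midAt_cons]; omega

theorem leafAt_lt (N : ℕ) (o s : Bool) (ℓ : ℕ) (w : List ℕ) :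
    leafAt N o s w < leafAt N o s (ℓ :: w) := by
  have := leafGap_pos o (kindOf s ℓ)
  rw [leafAt_cons]; omega

theorem midAt_pos (N : ℕ) (w : List ℕ) : 0 < midAt N w := by
  induction w with
  | nil => simp [nextAt]
  | cons ℓ w ih => exact ih.trans (midAt_lt N ℓ w)

theorem leafAt_pos (N : ℕ) (o s : Bool) (w : List ℕ) : 0 < leafAt N o s w := by
  induction w with
  | nil => cases o <;> cases s <;> simp [nextAt, leafStart]
  | cons ℓ w ih => exact ih.trans (leafAt_lt N o s ℓ w)

theorem TimelyLink.of_suffix {N : ℕ} {o s : Bool} {w v : List ℕ} {ℓ : ℕ}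
    (h : TimelyLink N o s w) (hv : ℓ :: v <:+ w) :
    (if o = true then midAt N v ≤ leafAt N o s v else leafAt N o s v ≤ midAt N v) ∧
      (kindOf s ℓ = .zero → leafAt N o s v = midAt N v) := by
  obtain ⟨r, rfl⟩ := hv
  cases o
  · have h1 := (Timely.of_append (show Timely _ _ _ _ from h)).1
    exact ⟨h1.1, fun hk => (h1.2 hk).symm⟩
  · exact (Timely.of_append (show Timely _ _ _ _ from h)).1

namespace Machine

variable {M : Machine} {W : Wiring} {N : ℕ} {γ : CTAConfig 3 1} {wd : List ℕ}

theorem leafLoc_ne_zero {o s : Bool} {ℓ : ℕ} {w : List ℕ} (h : M.Valid (ℓ :: w)) :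
    leafLoc o s w ≠ 0 := by
  intro h0
  obtain ⟨a, w', rfl, ha⟩ := eq_cons_of_leafLoc h0
  exact h.not_halt a (by simp) ha

/-- Brings one leaf up to date at the present time. The alternative in `hs` makes it harmless to
call this for a leaf that has already moved; `hm` says that a reading leaf comes after the middle.
-/
theorem Inv.exists_leaf_step {now τ : ℕ} {wm wl : Bool → List ℕ} (h : M.Inv W N γ now wm wl)
    (hγ : (M.net W N).Reaches γ) (hnow : now = τ + 1) (hwd : M.Valid wd) {s : Bool}
    (ht : TimelyLink N (W.out s) s wd)
    (hs : wl s = cut (leafAt N (W.out s) s) τ wd ∨ wl s = cut (leafAt N (W.out s) s) (τ + 1) wd)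
    (hm : W.out s = true → wm s = cut (midAt N) (τ + 1) wd) :
    ∃ γ', (M.net W N).Reaches γ' ∧ M.Inv W N γ' now wm
      (Function.update wl s (cut (leafAt N (W.out s) s) (τ + 1) wd)) := by
  by_cases hs1 : wl s = cut (leafAt N (W.out s) s) (τ + 1) wd
  · rw [← hs1, Function.update_eq_self]
    exact ⟨γ, hγ, h⟩
  have hs2 := hs.resolve_right hs1
  rcases cut_succ (τ := τ) (w := wd) (leafAt_lt N (W.out s) s) with h1 | ⟨ℓ, h1, h2⟩
  · exact absurd (hs2.trans h1.symm) hs1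
  rw [← hs2] at h1 h2
  rw [h1]
  have hsuf : ℓ :: wl s <:+ wd := h1 ▸ cut_suffix
  have hval : M.Valid (ℓ :: wl s) := by
    obtain ⟨r, rfl⟩ := hsuf
    exact hwd.of_append
  have hloc := leafLoc_ne_zero (o := W.out s) (s := s) hval
  have hord := ht.of_suffix hsuf
  obtain ⟨c, hc⟩ := (LinkInv.symm_iff.2 (h.link s)).exists_chanEffect (ℓ := ℓ) (h2.trans hnow.symm)
    (fun ho => by
      have ho' : W.out s = true := by simpa using ho
      rw [if_pos ho'] at hord
      refine ⟨?_, hord.2⟩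
      -- The middle writes this letter no later than the leaf reads it, hence it is among the
      -- letters that the middle has already sent.
      obtain ⟨r, hr⟩ := suffix_cut (τ := τ + 1) hsuf (hord.1.trans h2.le)
      exact ⟨r, (hm ho').trans hr.symm⟩)
  have hclock := h.leaf_clock s hloc
  have heq := leafAt_eq (N := N) hloc
  refine ⟨_, .tail hγ (CTA.step_iff.2 (.inr ⟨W.leaf s, timedTrans (leafLoc (W.out s) s (wl s))
    (leafWait N (W.out s) s (leafLoc (W.out s) s (wl s))) (commOp (!W.out s) W.mid ℓ (kindOf s ℓ))
    (leafNext (W.out s) s ℓ), c, ⟨?_, h.leaf_loc s, ?_⟩, hc, rfl⟩)),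
    h.leaf_event hloc (h2.trans hnow.symm) rfl rfl (by simp [timedTrans]) hc⟩
  · rw [net_leaf, mem_leafAut]
    refine .inr ⟨_, ℓ, hloc, ?_, letter_lt hval.1, rfl⟩
    cases wl s with
    | nil => simp [leafLoc]
    | cons a w => exact (leafNext_le _ _ _).le
  · rw [sat_timedTrans]
    omega

theorem Inv.exists_mid_step {now τ : ℕ} {wl : Bool → List ℕ}
    (h : M.Inv W N γ now (fun _ => cut (midAt N) τ wd) wl)
    (hγ : (M.net W N).Reaches γ) (hnow : now = τ + 1) (hwd : M.Valid wd)
    (ht : ∀ s, TimelyLink N (W.out s) s wd)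
    (hs : ∀ s, W.out s = false → wl s = cut (leafAt N (W.out s) s) (τ + 1) wd) :
    ∃ γ', (M.net W N).Reaches γ' ∧ M.Inv W N γ' now (fun _ => cut (midAt N) (τ + 1) wd) wl := by
  rcases cut_succ (τ := τ) (w := wd) (midAt_lt N) with h1 | ⟨ℓ, h1, h2⟩
  · rw [h1]
    exact ⟨γ, hγ, h⟩
  have hsuf : ℓ :: cut (midAt N) τ wd <:+ wd := h1 ▸ cut_suffix
  rw [h1]
  generalize cut (midAt N) τ wd = w at *
  have hval : M.Valid (ℓ :: w) := by
    obtain ⟨r, rfl⟩ := hsuf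
    exact hwd.of_append
  have hread : ∀ s, W.out s = false →
      (∃ r, wl s = r ++ ℓ :: w) ∧ (kindOf s ℓ = .zero → midAt N w = leafAt N (W.out s) s w) := by
    intro s ho
    have hord := (ht s).of_suffix hsuf
    rw [if_neg (by simp [ho])] at hord
    refine ⟨?_, fun hk => (hord.2 hk).symm⟩
    obtain ⟨r, hr⟩ := suffix_cut (τ := τ + 1) hsuf (hord.1.trans h2.le)
    exact ⟨r, (hs s ho).trans hr.symm⟩
  have hq := M.src_ne _ hval.1
  obtain ⟨-, hloc, hclock⟩ := h.valid
  have hclock := hclock hq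
  have heq := midAt_eq (N := N) hval.2
  obtain ⟨c, hc⟩ := (h.link false).exists_chanEffect (ℓ := ℓ) (h2.trans hnow.symm) (hread false)
  -- The two exchanges of the letter happen with no time in between; the first resets the clock, so
  -- the second finds it at `0`.
  have hinv := h.mid_event_false (γ' := ⟨Function.update γ.loc W.mid (M.numStates + ℓ),
    Function.update γ.val W.mid fun _ => 0, c⟩) hval.1 (h2.trans hnow.symm) rfl rfl rfl hc
  obtain ⟨c', hc'⟩ := (hinv.link true).exists_chanEffect (ℓ := ℓ) (h2.trans hnow.symm) (hread true)
  refine ⟨_, .tail (.tail hγ (CTA.step_iff.2 (.inr ⟨W.mid, timedTrans (stateAfter w)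
    (midWait N (stateAfter w)) (commOp (W.out false) (W.leaf false) ℓ (kindOf false ℓ))
    (M.numStates + ℓ), c, ⟨?_, hloc, ?_⟩, hc, rfl⟩))) (CTA.step_iff.2 (.inr ⟨W.mid,
    timedTrans (M.numStates + ℓ) 0 (commOp (W.out true) (W.leaf true) ℓ (kindOf true ℓ)) (ℓ / 8),
    c', ⟨?_, ?_, ?_⟩, hc', rfl⟩)), hinv.mid_event_true (v := fun _ => 0) hval
      (h2.trans hnow.symm) ?_ ?_ rfl hc'⟩
  · rw [net_mid, mem_midAut]
    exact .inr (.inl ⟨_, ℓ, hval.1, rfl⟩)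
  · rw [sat_timedTrans]
    omega
  · rw [net_mid, mem_midAut]
    exact .inr (.inr ⟨_, ℓ, hval.1, rfl⟩)
  · simp [CTAConfig.move, timedTrans]
  · rw [sat_timedTrans]
    simp [CTAConfig.move, timedTrans]
  · rfl
  · funext i
    by_cases hi : i = W.mid
    · subst hi
      funext x
      simp [CTAConfig.move, timedTrans, Subsingleton.elim x 0]
    · simp [CTAConfig.move, hi]

/-- Induction over time. Letters may have to be read in the very unit in which they are written, so
within each unit the writing leaves act first, then the middle, then the reading leaves. -/
theorem exists_reaches_inv (hwd : M.Valid wd) (ht : ∀ s, TimelyLink N (W.out s) s wd) (τ : ℕ) :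
    ∃ γ, (M.net W N).Reaches γ ∧ M.Inv W N γ τ (fun _ => cut (midAt N) τ wd)
      fun s => cut (leafAt N (W.out s) s) τ wd := by
  induction τ with
  | zero =>
    refine ⟨_, .refl, ?_⟩
    simp only [cut_zero (midAt_pos N), cut_zero (leafAt_pos N _ _)]
    exact .initial
  | succ τ ih =>
    obtain ⟨γ, hγ, h⟩ := ih
    replace hγ : (M.net W N).Reaches (γ.elapse 1) := .tail hγ (.time γ 1)
    replace h := h.elapse 1
    -- Moves the leaf if it writes and leaves it alone if it reads.
    have pre : ∀ s γ wl, (M.net W N).Reaches γ →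
        M.Inv W N γ (τ + 1) (fun _ => cut (midAt N) τ wd) wl →
        wl s = cut (leafAt N (W.out s) s) τ wd →
        ∃ γ' x, (M.net W N).Reaches γ' ∧
          M.Inv W N γ' (τ + 1) (fun _ => cut (midAt N) τ wd) (Function.update wl s x) ∧
          (x = cut (leafAt N (W.out s) s) τ wd ∨ x = cut (leafAt N (W.out s) s) (τ + 1) wd) ∧
          (W.out s = false → x = cut (leafAt N (W.out s) s) (τ + 1) wd) := by
      intro s γ wl hγ h hs
      by_cases ho : W.out s = true
      · exact ⟨γ, wl s, hγ, by rwa [Function.update_eq_self], .inl hs, by simp [ho]⟩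
      · obtain ⟨γ', h1, h2⟩ := h.exists_leaf_step hγ rfl hwd (ht s) (.inl hs) (absurd · ho)
        exact ⟨γ', _, h1, h2, .inr rfl, fun _ => rfl⟩
    obtain ⟨γ, x, hγ, h, hx, hx'⟩ := pre false _ _ hγ h rfl
    obtain ⟨γ, y, hγ, h, hy, hy'⟩ := pre true _ _ hγ h (by simp)
    obtain ⟨γ, hγ, h⟩ := h.exists_mid_step hγ rfl hwd ht (by
      intro s ho
      cases s
      · simpa using hx' ho
      · simpa using hy' ho)
    -- For a writing leaf, which has already moved, this call changes nothing.
    obtain ⟨γ, hγ, h⟩ := h.exists_leaf_step hγ rfl hwd (ht false) (by simpa using hx) fun _ => rfl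
    obtain ⟨γ, hγ, h⟩ := h.exists_leaf_step hγ rfl hwd (ht true) (by simpa using hy) fun _ => rfl
    refine ⟨γ, hγ, ?_⟩
    convert h using 1
    funext s
    cases s <;> simp

/-- The configuration that is reached when the machine halts. -/
def haltConfig (W : Wiring) : CTAConfig 3 1 where
  loc i := if i = W.mid then 1 else 0
  val _ _ := 0
  chan _ _ := []

theorem step_resetLoop {N : CTA 3 1} {γ : CTAConfig 3 1} {i : Fin 3} {q : ℕ}
    (h : resetLoop q ∈ (N.automata i).trans) (hq : γ.loc i = q) :
    N.Step γ ⟨γ.loc, Function.update γ.val i fun _ => 0, γ.chan⟩ := by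
  refine CTA.step_iff.2 (.inr ⟨i, resetLoop q, γ.chan, ⟨h, hq, by simp [resetLoop, Guard.Sat]⟩,
    rfl, ?_⟩)
  rw [move_resetLoop_loc hq]
  congr 2
  funext x
  simp [resetLoop, Subsingleton.elim x 0]

theorem Halts.reaches (h : M.Halts N) (W : Wiring) : (M.net W N).Reaches (haltConfig W) := by
  obtain ⟨ℓ, w, hw, hℓ, ⟨c, hc⟩, d, hd⟩ := h
  have ht : ∀ s, TimelyLink N (W.out s) s (ℓ :: w) := by
    -- The halting letter keeps both counters, so the run extends over it and its own exchange is
    -- timely as well.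
    have hk := fun s => kindOf_of_mod_eq_zero (M.halt_keep _ hw.1 hℓ) s
    intro s
    cases s
    · exact (timelyLink_of_exec (N := N) (s := false) (w := ℓ :: w) (c := c) ⟨c, hc, by rw [hk]; rfl⟩).1
    · exact (timelyLink_of_exec (N := N) (s := true) (w := ℓ :: w) (c := d) ⟨d, hd, by rw [hk]; rfl⟩).1
  -- The sum is a time at which all three automata have handled the last letter.
  obtain ⟨γ, hγ, h⟩ := exists_reaches_inv hw ht
    (midAt N w + leafAt N (W.out false) false w + leafAt N (W.out true) true w)
  have hcut : ∀ s, cut (leafAt N (W.out s) s)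
      (midAt N w + leafAt N (W.out false) false w + leafAt N (W.out true) true w) (ℓ :: w) =
      ℓ :: w := fun s => cut_cons_self (by cases s <;> omega)
  simp only [hcut] at h
  rw [cut_cons_self (by omega)] at h
  have hmid : γ.loc W.mid = 1 := h.valid.2.1.trans hℓ
  have hleaf : ∀ s, γ.loc (W.leaf s) = 0 := fun s => by
    rw [h.leaf_loc s, leafLoc, leafNext, if_pos hℓ]
  have hchan : ∀ i j, γ.chan i j = [] := by
    intro i j
    by_cases hij : ∀ s, (i, j) ≠ W.edge s
    · exact h.other i j hij
    · push Not at hij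
      obtain ⟨s, hs⟩ := hij
      have hlink := h.link s
      unfold LinkInv at hlink
      unfold Wiring.edge at hs
      split_ifs at hlink hs <;>
      · obtain ⟨rfl, rfl⟩ := Prod.mk.inj hs
        obtain ⟨r, hr, hc, -⟩ := hlink
        obtain rfl : r = [] := List.self_eq_append_left.1 hr
        exact hc
  have hmem : ∀ s, resetLoop 0 ∈ ((M.net W N).automata (W.leaf s)).trans := fun s => by
    rw [net_leaf, mem_leafAut]
    exact .inl rfl
  -- The reset loops in the final locations set all clocks to zero, so that the target configuration
  -- does not depend on the run.
  have h1 := Relation.ReflTransGen.tail hγ (step_resetLoop (i := W.mid) (q := 1)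
    (by rw [net_mid, mem_midAut]; exact .inl rfl) hmid)
  have h2 := h1.tail (step_resetLoop (hmem false) (hleaf false))
  have h3 := h2.tail (step_resetLoop (hmem true) (hleaf true))
  refine Eq.mp (congrArg _ ?_) h3
  rw [haltConfig, CTAConfig.mk.injEq]
  refine ⟨funext fun i => ?_, funext fun i => ?_, funext fun i => funext fun j => hchan i j⟩
  · rcases W.cases i with rfl | ⟨s, rfl⟩
    · rw [if_pos rfl, hmid]
    · rw [if_neg (W.leaf_ne s), hleaf]
  · simp only [Function.update_apply]
    rcases W.cases i with rfl | ⟨s, rfl⟩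
    · simp
    · cases s <;> simp

end Machine

/-! ### The reduction -/

theorem UndecidableOn.of_reduction {α : Type} [Primcodable α] {D P : α → Prop} {Q : ℕ → Prop}
    (hQ : ¬ ∃ f : ℕ → Bool, Computable f ∧ ∀ e, f e = true ↔ Q e) {r : ℕ → α}
    (hr : Computable r) (hD : ∀ e, D (r e)) (hP : ∀ e, P (r e) ↔ Q e) : UndecidableOn D P := by
  rintro ⟨f, hf, h⟩
  exact hQ ⟨fun e => f (r e), hf.comp hr, fun e => (h _ (hD e)).trans (hP e)⟩

/-! ### Computability of the reduction. -/

section Primrec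

theorem primrec_list_map_const {α β : Type} [Primcodable β] (l : List α) {f : α → ℕ → β}
    (hf : ∀ a, Primrec (f a)) : Primrec fun n => l.map fun a => f a n := by
  induction l with
  | nil => exact Primrec.const []
  | cons a l ih => exact Primrec.list_cons.comp (hf a) ih

theorem primrec_timedTrans (src : ℕ) {c : ℕ → ℕ} (hc : Primrec c) (op : ChanOp 3) (tgt : ℕ) :
    Primrec fun n => timedTrans src (c n) op tgt := by
  refine (Primrec.of_equiv_iff (Transition.equivProd 3 1)).1 ?_
  exact (Primrec.const src).pair (((Primrec.list_cons.comp ((Primrec.const (0 : Fin 1)).pair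
    ((Primrec.const Cmp.eq).pair hc)) (Primrec.const []))).pair (Primrec.const (op, [0], tgt)))

theorem primrec_timedAut (l q : ℕ) {t : ℕ → List (Transition 3 1)} (ht : Primrec t) :
    Primrec fun n => (⟨l, q, t n⟩ : TimedAut 3 1) := by
  refine (Primrec.of_equiv_iff (TimedAut.equivProd 3 1)).1 ?_
  exact (Primrec.const l).pair ((Primrec.const q).pair ht)

theorem primrec_leafStart (o s : Bool) : Primrec fun N => leafStart N o s := by
  cases s
  · cases o
    · exact Primrec.const 1
    · exact Primrec.succ.comp (Primrec.nat_mul.comp (Primrec.const 2) Primrec.id)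
  · cases o <;> exact Primrec.succ

variable (M : Machine) (W : Wiring)

theorem primrec_leafAut (s : Bool) : Primrec fun N => M.leafAut W N s := by
  refine primrec_timedAut _ _ (Primrec.list_cons.comp (Primrec.const _)
    (primrec_list_map_const _ fun p => primrec_timedTrans _ ?_ _ _))
  unfold leafWait
  split_ifs
  · exact primrec_leafStart _ _
  · exact Primrec.const _

theorem primrec_midAut : Primrec fun N => M.midAut W N := by
  refine primrec_timedAut _ _ (Primrec.list_cons.comp (Primrec.const _)
    (Primrec.list_append.comp (primrec_list_map_const _ fun p => primrec_timedTrans _ ?_ _ _)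
      (Primrec.const _)))
  unfold midWait
  split_ifs
  · exact Primrec.succ
  · exact Primrec.const _

/-- Machine and wiring are fixed; `N` occurs only in the constants of some guards. -/
theorem primrec_net : Primrec fun N => M.net W N := by
  refine (Primrec.of_equiv_iff (CTA.equivProd 3 1)).1 ?_
  refine Primrec.pair ?_ (Primrec.const ([W.edge false, W.edge true], 8 * M.numStates))
  refine Primrec.fin_curry.2 (Primrec.fin_curry₁.2 fun i => ?_ :
    Primrec₂ fun (i : Fin 3) (N : ℕ) => (M.net W N).automata i).swap
  unfold Machine.net
  by_cases hi : i = W.mid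
  · simp only [hi, if_true]
    exact primrec_midAut M W
  · simp only [if_neg hi]
    exact primrec_leafAut M W _

end Primrec

/-! ### Well-formedness of the network and equivalence with halting. -/

namespace Machine

variable {M : Machine} {W : Wiring} {N : ℕ}

theorem net_topology : (M.net W N).topology = {W.edge false, W.edge true} := by
  simp [CTA.topology, net]

theorem edge_mem_topology (s : Bool) : W.edge s ∈ (M.net W N).topology := by
  rw [net_topology]
  cases s <;> simp

theorem opAllowed_mid {s : Bool} {ℓ : ℕ} (hℓ : ℓ < 8 * M.numStates) :
    (M.net W N).OpAllowed W.mid (commOp (W.out s) (W.leaf s) ℓ (kindOf s ℓ)) := by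
  have h := edge_mem_topology (M := M) (W := W) (N := N) s
  unfold Wiring.edge at h
  unfold commOp
  split_ifs at h ⊢ <;> exact ⟨h, hℓ⟩

theorem opAllowed_leaf {s : Bool} {ℓ : ℕ} (hℓ : ℓ < 8 * M.numStates) :
    (M.net W N).OpAllowed (W.leaf s) (commOp (!W.out s) W.mid ℓ (kindOf s ℓ)) := by
  have h := edge_mem_topology (M := M) (W := W) (N := N) s
  rw [W.edge_eq_not] at h
  unfold commOp
  split_ifs at h ⊢ <;> exact ⟨h, hℓ⟩

theorem net_wellFormed (M : Machine) (W : Wiring) (N : ℕ) : (M.net W N).WellFormed := by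
  have h2 := M.two_le
  intro i
  rcases W.cases i with rfl | ⟨s, rfl⟩
  · rw [net_mid]
    refine ⟨show 0 < 9 * M.numStates by omega, fun e he => ?_⟩
    change e.src < 9 * M.numStates ∧ e.tgt < 9 * M.numStates ∧ _
    rcases mem_midAut.1 he with rfl | ⟨q, ℓ, hE, rfl⟩ | ⟨q, ℓ, hE, rfl⟩
    · exact ⟨show 1 < _ by omega, show 1 < _ by omega, trivial⟩
    · have h3 : q < M.numStates := M.src_lt _ hE
      have h4 := letter_lt hE
      exact ⟨show q < _ by omega, show M.numStates + ℓ < _ by omega, opAllowed_mid h4⟩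
    · have h4 := letter_lt hE
      exact ⟨show M.numStates + ℓ < _ by omega, show ℓ / 8 < _ by omega, opAllowed_mid h4⟩
  · rw [net_leaf]
    refine ⟨show 4 < 5 by omega, fun e he => ?_⟩
    change e.src < 5 ∧ e.tgt < 5 ∧ _
    rcases mem_leafAut.1 he with rfl | ⟨q, ℓ, hq0, hq, hℓ, rfl⟩
    · exact ⟨show 0 < 5 by omega, show 0 < 5 by omega, trivial⟩
    · have := leafNext_le (W.out s) s ℓ
      exact ⟨show q < 5 by omega, show leafNext _ _ _ < 5 by omega, opAllowed_leaf hℓ⟩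

theorem haltConfig_lt (M : Machine) (W : Wiring) (N : ℕ) (i : Fin 3) :
    (haltConfig W).loc i < ((M.net W N).automata i).numLocs := by
  have h2 := M.two_le
  rcases W.cases i with rfl | ⟨s, rfl⟩
  · rw [net_mid]
    simp only [haltConfig, if_true, midAut]
    omega
  · rw [net_leaf]
    simp [haltConfig, W.leaf_ne, leafAut]

theorem isConfig_haltConfig (M : Machine) (W : Wiring) (N : ℕ) :
    (M.net W N).IsConfig (haltConfig W) :=
  ⟨haltConfig_lt M W N, fun _ _ => ⟨fun _ => rfl, by simp [haltConfig], by simp [haltConfig]⟩⟩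

theorem halts_of_reaches {γ : CTAConfig 3 1} (hγ : (M.net W N).Reaches γ)
    (hm : γ.loc W.mid = 1) (hl : ∀ s, W.out s = true → γ.loc (W.leaf s) = 0) : M.Halts N := by
  obtain ⟨_, _, _, h⟩ := exists_inv hγ
  exact h.halts hm hl

theorem reaches_haltConfig_iff : (M.net W N).Reaches (haltConfig W) ↔ M.Halts N :=
  ⟨fun h => halts_of_reaches h (by simp [haltConfig]) (by simp [haltConfig, W.leaf_ne]),
    fun h => h.reaches W⟩

theorem reaches_locs_iff :
    (∃ γ, (M.net W N).Reaches γ ∧ ∀ i, γ.loc i = (haltConfig W).loc i) ↔ M.Halts N := by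
  constructor
  · rintro ⟨γ, hγ, h⟩
    exact halts_of_reaches hγ (by simp [h, haltConfig]) (by simp [h, haltConfig, W.leaf_ne])
  · exact fun h => ⟨_, h.reaches W, fun _ => rfl⟩

/-- The automaton to which all information flows, unless both channels leave the middle. -/
def _root_.Wiring.sink (W : Wiring) : Fin 3 := if W.out true = true then W.leaf true else W.mid

/-- If the leaf `true` reads, its final location forces the middle to have halted; otherwise no leaf
reads and the location of the middle suffices. -/
theorem reaches_sink_iff (h₁ : W.out false = false) :
    (∃ γ, (M.net W N).Reaches γ ∧ γ.loc W.sink = (haltConfig W).loc W.sink) ↔ M.Halts N := by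
  constructor
  · rintro ⟨γ, hγ, h⟩
    unfold Wiring.sink at h
    split_ifs at h with h2
    · simp only [haltConfig, if_neg (W.leaf_ne true)] at h
      obtain ⟨_, _, _, hinv⟩ := exists_inv hγ
      refine halts_of_reaches hγ (hinv.mid_halted h2 h) fun s hs => ?_
      cases s
      · simp [h₁] at hs
      · exact h
    · simp only [haltConfig, if_true] at h
      refine halts_of_reaches hγ h fun s hs => ?_
      cases s
      · simp [h₁] at hs
      · exact absurd hs h2
  · exact fun h => ⟨_, h.reaches W, rfl⟩

end Machine

/-! ### Topologies and the main theorem. -/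

/-- Each acyclic topology on three automata with two channels is given by a wiring. -/
theorem exists_wiring {T : Finset (Fin 3 × Fin 3)} (hT : IsPolyforest T) (hcard : T.card = 2) :
    ∃ W : Wiring, T = {W.edge false, W.edge true} ∧ (W.out false = true → W.out true = true) := by
  have build : ∀ (m a b : Fin 3) (oa ob : Bool), a ≠ b → a ≠ m → b ≠ m →
      (oa = true → ob = true) →
      T = {if oa = true then (m, a) else (a, m), if ob = true then (m, b) else (b, m)} →
      ∃ W : Wiring, T = {W.edge false, W.edge true} ∧
        (W.out false = true → W.out true = true) := by
    intro m a b oa ob hab ham hbm ho h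
    refine ⟨⟨m, fun s => cond s b a, fun s => cond s ob oa, ?_, ?_⟩, h, ho⟩
    · intro s s' hs
      cases s <;> cases s' <;> simp_all
    · intro s
      cases s <;> simpa
  obtain ⟨⟨x₁, x₂⟩, ⟨y₁, y₂⟩, hxy, rfl⟩ := Finset.card_eq_two.1 hcard
  obtain ⟨hloop, hanti, -⟩ := hT
  have hx : x₁ ≠ x₂ := by rintro rfl; exact hloop x₁ (by simp)
  have hy : y₁ ≠ y₂ := by rintro rfl; exact hloop y₁ (by simp)
  have hne : ¬ (x₁ = y₂ ∧ x₂ = y₁) := by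
    rintro ⟨rfl, rfl⟩
    exact hanti x₁ x₂ (by simp) (by simp)
  have hne' : ¬ (x₁ = y₁ ∧ x₂ = y₂) := by simpa using hxy
  -- Two edges on three nodes share a node, which becomes the middle.
  have hcase : x₁ = y₁ ∨ x₂ = y₂ ∨ x₂ = y₁ ∨ x₁ = y₂ := by omega
  rcases hcase with rfl | rfl | rfl | rfl
  · exact build x₁ x₂ y₂ true true (by tauto) hx.symm hy.symm (by simp) rfl
  · exact build x₂ x₁ y₁ false false (by tauto) hx hy (by simp) rfl
  · exact build x₂ x₁ y₂ false true (by tauto) hx hy.symm (by simp) rfl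
  -- In a pipeline the leaf `true` is always the last automaton, so the two edges are swapped here.
  · exact build x₁ y₁ x₂ false true (by tauto) hy hx.symm (by simp) (Finset.pair_comm _ _)

/-- Otherwise both channels leave the middle; a leaf then has no outgoing edge, and the root would
have to be each of the two leaves. -/
theorem Wiring.out_false_of_root {W : Wiring} {T : Finset (Fin 3 × Fin 3)}
    (hT : T = {W.edge false, W.edge true}) (ho : W.out false = true → W.out true = true)
    (hr : ∃ r, ∀ i, Relation.ReflTransGen (fun a b => (a, b) ∈ T) i r) : W.out false = false := by
  by_contra h
  have h1 : W.out false = true := by simpa using h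
  have h2 := ho h1
  obtain ⟨r, hr⟩ := hr
  have key : ∀ s, W.leaf s = r := by
    intro s
    rcases (hr (W.leaf s)).cases_head with h | ⟨c, hc, -⟩
    · exact h
    · simp [hT, Wiring.edge, h1, h2, W.leaf_ne] at hc
  exact absurd (W.leaf_inj ((key false).trans (key true).symm)) (by simp)

/-- Undecidability of reachability for three one-clock timed automata without global clocks, for
each acyclic topology `T` with two channels: reachability of a configuration, of a tuple of control
locations, and, if some automaton can be reached from all others in `T`, also of a single control
location of one automaton. -/
theorem theorem2 (T : Finset (Fin 3 × Fin 3)) (hT : IsPolyforest T) (hcard : T.card = 2) :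
    UndecidableOn
      (fun I : CTA 3 1 × CTAConfig 3 1 =>
        I.1.WellFormed ∧ I.1.topology = T ∧ I.1.IsConfig I.2)
      (fun I => I.1.Reaches I.2) ∧
    UndecidableOn
      (fun I : CTA 3 1 × (Fin 3 → ℕ) =>
        I.1.WellFormed ∧ I.1.topology = T ∧ ∀ i, I.2 i < (I.1.automata i).numLocs)
      (fun I => ∃ γ, I.1.Reaches γ ∧ ∀ i, γ.loc i = I.2 i) ∧
    ((∃ r, ∀ i, Relation.ReflTransGen (fun a b => (a, b) ∈ T) i r) →
      UndecidableOn
        (fun I : CTA 3 1 × Fin 3 × ℕ =>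
          I.1.WellFormed ∧ I.1.topology = T ∧ I.2.2 < (I.1.automata I.2.1).numLocs)
        (fun I => ∃ γ, I.1.Reaches γ ∧ γ.loc I.2.1 = I.2.2)) := by
  obtain ⟨W, hW, ho⟩ := exists_wiring hT hcard
  obtain ⟨M, g, hg, hM⟩ := Machine.exists_undecidable
  have hnet : Computable fun e => M.net W (g e) := (primrec_net M W).to_comp.comp hg
  have htop : ∀ e, (M.net W (g e)).topology = T := fun e => Machine.net_topology.trans hW.symm
  refine ⟨?_, ?_, fun hr => ?_⟩
  · exact .of_reduction hM (r := fun e => (M.net W (g e), Machine.haltConfig W))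
      (hnet.pair (Computable.const _))
      (fun e => ⟨M.net_wellFormed W _, htop e, M.isConfig_haltConfig W _⟩)
      fun e => Machine.reaches_haltConfig_iff
  · exact .of_reduction hM (r := fun e => (M.net W (g e), (Machine.haltConfig W).loc))
      (hnet.pair (Computable.const _))
      (fun e => ⟨M.net_wellFormed W _, htop e, M.haltConfig_lt W _⟩)
      fun e => Machine.reaches_locs_iff
  · exact .of_reduction hM
      (r := fun e => (M.net W (g e), W.sink, (Machine.haltConfig W).loc W.sink))
      (hnet.pair (Computable.const _))
      (fun e => ⟨M.net_wellFormed W _, htop e, M.haltConfig_lt W _ _⟩)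
      fun e => Machine.reaches_sink_iff (Wiring.out_false_of_root hW ho hr)
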